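/- \textbf{Theorem (expectation bound for canonical U-statistics).} There is an absolute constant $K>0$ such that the following holds. Let $b>0$ be a real number and let $n\ge 2$ and $p$ be integers with $2\le p\le e^{bn}$. Let $F$ be a Borel probability measure on $\mathbb{R}^p$, and let $X_1,\dots,X_n,X'_1,\dots,X'_n$ be independent random vectors, each with law $F$ (so that $(X'_1,\dots,X'_n)$ is an independent copy of $(X_1,\dots,X_n)$). Let $X,X'$ denote generic independent random vectors with law $F$, and write $\|A\|=\max_{1\le m,k\le p}|A_{mk}|$ for a $p\times p$ matrix $A$. Let $f=(f_{mk}):\mathbb{R}^p\times\mathbb{R}^p\to\mathbb{R}^{p\times p}$ be a measurable kernel with $\mathbb{E}\|f(X,X')\|<\infty$ that is symmetric, i.e. $f(x_1,x_2)=f(x_2,x_1)$ for all $x_1,x_2\in\mathbb{R}^p$, and canonical with respect to $F$, i.e. for all $m,k$ and all $x_1,x_2\in\mathbb{R}^p$ the expectations below exist and $$\mathbb{E}f_{mk}(x_1,X')=\mathbb{E}f_{mk}(X,x_2)=\mathbb{E}f_{mk}(X,X')=0 .$$ Put $$V=\binom{n}{2}^{-1}\sum_{1\le i<j\le n}f(X_i,X_j),\qquad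 M=\max_{1\le i<j\le n}\bigl(\|f(X_i,X_j)\|\vee\|f(X_i,X'_j)\|\bigr),$$ $$\|M\|_4=(\mathbb{E}M^4)^{1/4},\qquad D_q=\max_{1\le m,k\le p}\bigl(\mathbb{E}|f_{mk}(X,X')|^q\bigr)^{1/q}\quad(q>0),$$ where moments take values in $[0,\infty]$. Then $$\mathbb{E}\|V\|\le K\,(1\vee b^{1/2})\left\{\left(\frac{\log p}{n}\right)^{3/2}\|M\|_4+\frac{\log p}{n}\,D_2+\left(\frac{\log p}{n}\right)^{5/4}D_4\right\}.$$ -/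

import Mathlib

open MeasureTheory ProbabilityTheory
open scoped ENNReal

noncomputable section

/-- A matrix-valued kernel of order two on `ℝ^p`, with values in the `p × p` real matrices. -/
abbrev MatrixKernel (p : ℕ) : Type :=
  (Fin p → ℝ) → (Fin p → ℝ) → Matrix (Fin p) (Fin p) ℝ

/-- The entrywise maximum norm `‖A‖ = max_{m,k} |A m k|` of a matrix. -/
def maxNorm {p : ℕ} (A : Matrix (Fin p) (Fin p) ℝ) : ℝ :=
  ⨆ m : Fin p, ⨆ k : Fin p, |A m k|

/-- Joint (entrywise) measurability of a kernel. -/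
def MatrixKernel.IsMeasurable {p : ℕ} (f : MatrixKernel p) : Prop :=
  ∀ m k : Fin p, Measurable fun z : (Fin p → ℝ) × (Fin p → ℝ) => f z.1 z.2 m k

/-- The kernel is symmetric in its two arguments. -/
def MatrixKernel.IsSymmetric {p : ℕ} (f : MatrixKernel p) : Prop :=
  ∀ x₁ x₂ : Fin p → ℝ, f x₁ x₂ = f x₂ x₁

/-- The kernel is canonical (completely degenerate) with respect to the law `F`:
for independent `X, X'` with law `F`, all the expectations `E f_{mk}(x₁, X')`,
`E f_{mk}(X, x₂)` and `E f_{mk}(X, X')` exist and vanish. -/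
structure MatrixKernel.IsCanonical {p : ℕ} (f : MatrixKernel p)
    (F : Measure (Fin p → ℝ)) : Prop where
  integrable_left : ∀ (m k : Fin p) (x₁ : Fin p → ℝ), Integrable (fun y => f x₁ y m k) F
  integral_left : ∀ (m k : Fin p) (x₁ : Fin p → ℝ), ∫ y, f x₁ y m k ∂F = 0
  integrable_right : ∀ (m k : Fin p) (x₂ : Fin p → ℝ), Integrable (fun x => f x x₂ m k) F
  integral_right : ∀ (m k : Fin p) (x₂ : Fin p → ℝ), ∫ x, f x x₂ m k ∂F = 0
  integrable_prod : ∀ m k : Fin p, Integrable (fun z => f z.1 z.2 m k) (F.prod F)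
  integral_prod : ∀ m k : Fin p, ∫ z, f z.1 z.2 m k ∂(F.prod F) = 0

/-- The U-statistic `(n choose 2)⁻¹ ∑_{i < j} f(x_i, x_j)` of the points `x_1, …, x_n`. -/
def MatrixKernel.uStat {p n : ℕ} (f : MatrixKernel p) (x : Fin n → Fin p → ℝ) :
    Matrix (Fin p) (Fin p) ℝ :=
  ((n.choose 2 : ℕ) : ℝ)⁻¹ • ∑ i : Fin n, ∑ j ∈ Finset.Ioi i, f (x i) (x j)

/-- `max_{i < j} (‖f(x_i, x_j)‖ ∨ ‖f(x_i, x'_j)‖)`. -/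
def MatrixKernel.maxKernel {p n : ℕ} (f : MatrixKernel p) (x x' : Fin n → Fin p → ℝ) : ℝ :=
  ⨆ ij : {ij : Fin n × Fin n // ij.1 < ij.2},
    max (maxNorm (f (x ij.1.1) (x ij.1.2))) (maxNorm (f (x ij.1.1) (x' ij.1.2)))

/-- `D_q = max_{m,k} (E |f_{mk}(X, X')|^q)^{1/q}` for independent `X, X'` with law `F`;
it is `∞` if one of the moments is infinite. -/
def MatrixKernel.entryNorm {p : ℕ} (f : MatrixKernel p) (F : Measure (Fin p → ℝ))
    (q : ℝ≥0∞) : ℝ≥0∞ :=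
  ⨆ m : Fin p, ⨆ k : Fin p,
    eLpNorm (fun z : (Fin p → ℝ) × (Fin p → ℝ) => f z.1 z.2 m k) q (F.prod F)

end

/-! The pair sum is reduced to a Rademacher chaos with fixed coefficients, whose maximum over the `p
^ 2` entries costs one factor `log p`.

Decoupling needs no second sample. If the indices are split by random signs, each ordered pair is
separated in a quarter of the splits, so the sum over `i < j` is twice the average over splits of
the sum between the two blocks (`sum_split_eq`). The blocks of one split are independent. Since the
kernel is canonical, inserting any fixed signs in each variable costs a factor 4 in expectation
(`lintegral_enorm_bilinear_le_sgn`), and one may average over the signs.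

With the data fixed, exponential moments bound the average maximum of the chaos by a constant times
`σ log p`, with `σ ^ 2` the largest entrywise sum of squares (`signAvg_chaos_norm_le`). By Jensen it
remains to bound `E σ ^ 2`. A maximal inequality for nonnegative i.i.d. sums
(`lintegral_iSup_sum_le`), applied once in each variable, gives order `n ^ 2 D_2 ^ 2 + n log p E M ^
2`. Taking the root, using `E M ^ 2 ≤ ‖M‖_4 ^ 2` and multiplying by `log p / n ^ 2` produces the
`D_2` and `‖M‖_4` terms. These two terms already bound the expectation, so the `D_4` term and the
factor `1 ∨ b ^ (1/2)` are only slack. -/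

/-- The average over all sign patterns. -/
noncomputable def signAvg (ι : Type*) [Fintype ι] (φ : (ι → ℤˣ) → ℝ) : ℝ :=
  open Classical in (∑ s : ι → ℤˣ, φ s) / 2 ^ Fintype.card ι

/-! ### Exponential moments and maxima of Rademacher sums and chaoses. -/

section Signs

variable {ι κ T : Type*} [Fintype ι] [Fintype κ] [Fintype T]

/-- The real number attached to a sign. -/
noncomputable abbrev sgn (u : ℤˣ) : ℝ := ((u : ℤ) : ℝ)

theorem card_signs [DecidableEq ι] : Fintype.card (ι → ℤˣ) = 2 ^ Fintype.card ι := by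
  simp [Fintype.card_units_int]

theorem signAvg_mono {φ ψ : (ι → ℤˣ) → ℝ} (h : ∀ s, φ s ≤ ψ s) :
    signAvg ι φ ≤ signAvg ι ψ := by
  unfold signAvg
  gcongr
  exact h _

theorem signAvg_const (c : ℝ) : signAvg ι (fun _ => c) = c := by
  classical
  unfold signAvg
  simp [Fintype.card_units_int]

theorem signAvg_add (φ ψ : (ι → ℤˣ) → ℝ) :
    signAvg ι (fun s => φ s + ψ s) = signAvg ι φ + signAvg ι ψ := by
  unfold signAvg
  rw [Finset.sum_add_distrib, add_div]

theorem signAvg_sum {S : Type*} (A : Finset S) (φ : S → (ι → ℤˣ) → ℝ) :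
    signAvg ι (fun s => ∑ t ∈ A, φ t s) = ∑ t ∈ A, signAvg ι (φ t) := by
  unfold signAvg
  rw [Finset.sum_comm, Finset.sum_div]

theorem signAvg_const_mul (c : ℝ) (φ : (ι → ℤˣ) → ℝ) :
    signAvg ι (fun s => c * φ s) = c * signAvg ι φ := by
  unfold signAvg
  rw [← Finset.mul_sum, mul_div_assoc]

theorem signAvg_le_of_le {φ : (ι → ℤˣ) → ℝ} {c : ℝ} (h : ∀ s, φ s ≤ c) : signAvg ι φ ≤ c :=
  (signAvg_mono h).trans_eq (signAvg_const c)

theorem signAvg_nonneg {φ : (ι → ℤˣ) → ℝ} (h : ∀ s, 0 ≤ φ s) : 0 ≤ signAvg ι φ := by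
  unfold signAvg
  exact div_nonneg (Finset.sum_nonneg fun s _ => h s) (by positivity)

/-- The signs are independent, so the average factors into `∏ cosh (a i)`, and `cosh x ≤ exp (x ^ 2
/ 2)`. -/
theorem signAvg_exp_le (a : ι → ℝ) :
    signAvg ι (fun s => Real.exp (∑ i, sgn (s i) * a i)) ≤ Real.exp ((∑ i, a i ^ 2) / 2) := by
  classical
  have h1 : ∑ s : ι → ℤˣ, Real.exp (∑ i, sgn (s i) * a i) = ∏ i, (2 * Real.cosh (a i)) := by
    have := Finset.prod_univ_sum (fun _ : ι => (Finset.univ : Finset ℤˣ))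
      (fun i u => Real.exp (sgn u * a i))
    rw [Fintype.piFinset_univ] at this
    simp_rw [Real.exp_sum]
    rw [← this]
    refine Finset.prod_congr rfl fun i _ => ?_
    have hu : (Finset.univ : Finset ℤˣ) = {1, -1} := by decide
    rw [hu, Finset.sum_pair (by decide), Real.cosh_eq]
    simp [sgn]
    ring
  have h2 : signAvg ι (fun s => Real.exp (∑ i, sgn (s i) * a i)) = ∏ i, Real.cosh (a i) := by
    unfold signAvg
    rw [div_eq_iff (by positivity)]
    rw [Finset.prod_mul_distrib, Finset.prod_const, Finset.card_univ] at h1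
    rw [mul_comm, ← h1]
  rw [h2, Finset.sum_div, Real.exp_sum]
  exact Finset.prod_le_prod (fun i _ => (Real.cosh_pos _).le)
    fun i _ => Real.cosh_le_exp_half_sq _

theorem exp_abs_le (x : ℝ) : Real.exp |x| ≤ Real.exp x + Real.exp (-x) := by
  rcases abs_cases x with ⟨h, _⟩ | ⟨h, _⟩ <;> rw [h] <;> linarith [Real.exp_pos x, Real.exp_pos (-x)]

theorem signAvg_exp_abs_le (a : ι → ℝ) :
    signAvg ι (fun s => Real.exp |∑ i, sgn (s i) * a i|) ≤
      2 * Real.exp ((∑ i, a i ^ 2) / 2) := by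
  refine (signAvg_mono fun s => exp_abs_le _).trans ?_
  rw [signAvg_add, two_mul]
  refine add_le_add (signAvg_exp_le a) ?_
  have := signAvg_exp_le (fun i => -a i)
  simpa using this

/-- A linearised form of the bound on a maximum by exponential moments. -/
theorem norm_le_log_add_sum_exp [Nonempty T] (v : T → ℝ) {K l : ℝ} (hK : 0 < K) :
    l * ‖v‖ ≤ Real.log K - 1 + K⁻¹ * ∑ t, Real.exp (l * |v t|) := by
  obtain ⟨t, ht⟩ : ∃ t, ‖v‖ = |v t| := by
    obtain ⟨t, ht⟩ := Finite.exists_max fun t => |v t|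
    exact ⟨t, le_antisymm ((pi_norm_le_iff_of_nonneg (abs_nonneg _)).2 ht) (norm_le_pi_norm v t)⟩
  rw [ht]
  have h1 : Real.exp (l * |v t|) ≤ ∑ t, Real.exp (l * |v t|) :=
    Finset.single_le_sum (f := fun t => Real.exp (l * |v t|))
      (fun _ _ => (Real.exp_pos _).le) (Finset.mem_univ t)
  -- This is the tangent line of the logarithm at `K`. The resulting bound is linear in the
  -- exponentials, so it can be averaged without Jensen.
  have h2 := Real.add_one_le_exp (l * |v t| - Real.log K)
  rw [Real.exp_sub, Real.exp_log hK] at h2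
  have h3 : Real.exp (l * |v t|) / K ≤ K⁻¹ * ∑ t, Real.exp (l * |v t|) := by
    rw [div_eq_inv_mul]; gcongr
  linarith

/-- The expected maximum of Rademacher sums, with a free parameter. -/
theorem signAvg_norm_le [Nonempty T] (a : ι → T → ℝ) {V l : ℝ} (hl : 0 < l)
    (hV : ∀ t, ∑ i, a i t ^ 2 ≤ V) :
    signAvg ι (fun s => ‖∑ i, sgn (s i) • a i‖) ≤
      Real.log (2 * Fintype.card T) / l + l * V / 2 := by
  -- `K` bounds the sum over `t` of the averaged exponentials, so the last term of
  -- `norm_le_log_add_sum_exp` is at most 1 and cancels the `-1`.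
  set K : ℝ := 2 * Fintype.card T * Real.exp (l ^ 2 * V / 2) with hKdef
  have hT : (0 : ℝ) < Fintype.card T := by exact_mod_cast Fintype.card_pos
  have hK : 0 < K := by positivity
  have h1 : l * signAvg ι (fun s => ‖∑ i, sgn (s i) • a i‖) ≤ Real.log K := by
    rw [← signAvg_const_mul]
    refine (signAvg_mono fun s => norm_le_log_add_sum_exp _ hK).trans ?_
    rw [signAvg_add, signAvg_const, signAvg_const_mul, signAvg_sum]
    have : ∀ t, signAvg ι (fun s => Real.exp (l * |(∑ i, sgn (s i) • a i) t|)) ≤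
        2 * Real.exp (l ^ 2 * V / 2) := by
      intro t
      have := signAvg_exp_abs_le (fun i => l * a i t)
      have e : ∀ s : ι → ℤˣ, l * |(∑ i, sgn (s i) • a i) t| =
          |∑ i, sgn (s i) * (l * a i t)| := by
        intro s
        rw [← abs_of_pos hl, ← abs_mul, abs_of_pos hl, Finset.sum_apply, Finset.mul_sum]
        congr 1
        refine Finset.sum_congr rfl fun i _ => ?_
        simp; ring
      simp_rw [e]
      refine this.trans ?_
      gcongr
      simp_rw [mul_pow]
      rw [← Finset.mul_sum]
      gcongr
      exact hV t
    have h2 := Finset.sum_le_sum fun t (_ : t ∈ Finset.univ) => this t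
    rw [Finset.sum_const, Finset.card_univ, nsmul_eq_mul] at h2
    have h3 : K⁻¹ * ∑ t, signAvg ι (fun s => Real.exp (l * |(∑ i, sgn (s i) • a i) t|)) ≤ 1 := by
      rw [inv_mul_le_iff₀ hK, mul_one]
      refine h2.trans_eq ?_
      rw [hKdef]; ring
    linarith
  rw [hKdef, Real.log_mul (by positivity) (by positivity), Real.log_exp] at h1
  rw [← mul_le_mul_iff_right₀ hl]
  refine h1.trans_eq ?_
  field_simp

theorem integral_exp_sq_div_four : ∫ x, Real.exp (x ^ 2 / 4) ∂(gaussianReal 0 1) = √2 := by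
  rw [integral_gaussianReal_eq_integral_smul (by norm_num)]
  have : ∀ x : ℝ, gaussianPDFReal 0 1 x • Real.exp (x ^ 2 / 4) =
      (√(2 * Real.pi))⁻¹ * Real.exp (-(1 / 4) * x ^ 2) := by
    intro x
    rw [gaussianPDFReal, smul_eq_mul, mul_assoc, ← Real.exp_add]
    simp
    ring_nf
    tauto
  simp_rw [this]
  rw [integral_const_mul, integral_gaussian, inv_mul_eq_div, ← Real.sqrt_div' _ (by positivity)]
  congr 1
  field_simp
  norm_num

/-- A non-integrable function has Bochner integral 0, so the value `√2` already forces
integrability. -/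
theorem integrable_exp_sq_div_four :
    Integrable (fun x : ℝ => Real.exp (x ^ 2 / 4)) (gaussianReal 0 1) := by
  by_contra h
  have := integral_exp_sq_div_four
  rw [integral_undef h] at this
  have h2 : 0 < √(2 : ℝ) := by positivity
  linarith

/-- The Gaussian moment generating function linearises the square, so that the bound for
exponentials of Rademacher sums applies under the integral. -/
theorem exp_sq_eq_integral {c : ℝ} (hc : 0 ≤ c) (S : ℝ) :
    Real.exp (c * S ^ 2) = ∫ x, Real.exp (√(2 * c) * S * x) ∂(gaussianReal 0 1) := by
  have := congrFun (mgf_id_gaussianReal (μ := 0) (v := 1)) (√(2 * c) * S)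
  rw [mgf] at this
  simp only [id] at this
  rw [this]
  congr 1
  rw [mul_pow, Real.sq_sqrt (by positivity)]
  simp
  ring

/-- Rademacher sums have a Gaussian square-exponential moment. -/
theorem signAvg_exp_sq_le (a : ι → ℝ) {c : ℝ} (hc : 0 ≤ c) (h : c * ∑ i, a i ^ 2 ≤ 1 / 4) :
    signAvg ι (fun s => Real.exp (c * (∑ i, sgn (s i) * a i) ^ 2)) ≤ √2 := by
  simp_rw [exp_sq_eq_integral hc]
  have hint : ∀ s : ℝ, Integrable (fun x => Real.exp (s * x)) (gaussianReal 0 1) :=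
    fun s => integrable_exp_mul_gaussianReal s
  have h1 : signAvg ι (fun s => ∫ x, Real.exp (√(2 * c) * (∑ i, sgn (s i) * a i) * x)
      ∂(gaussianReal 0 1)) = ∫ x, signAvg ι (fun s =>
        Real.exp (√(2 * c) * (∑ i, sgn (s i) * a i) * x)) ∂(gaussianReal 0 1) := by
    unfold signAvg
    rw [integral_div, integral_finsetSum]
    intro s _
    exact hint _
  rw [h1, ← integral_exp_sq_div_four]
  refine integral_mono ?_ integrable_exp_sq_div_four fun x => ?_
  · unfold signAvg
    exact (integrable_finsetSum _ fun s _ => hint _).div_const _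
  · have := signAvg_exp_le (fun i => √(2 * c) * x * a i)
    refine (le_of_eq ?_).trans (this.trans ?_)
    · congr 1
      ext s
      rw [Finset.mul_sum, Finset.sum_mul]
      congr 1
      refine Finset.sum_congr rfl fun i _ => ?_
      ring
    · simp only [mul_pow]
      rw [Real.exp_le_exp, ← Finset.mul_sum, Real.sq_sqrt (by positivity)]
      nlinarith [sq_nonneg x]

/-- Square-exponential moment of a vector of Rademacher sums. -/
theorem signAvg_exp_sum_sq_le (a : ι → κ → ℝ) {c : ℝ} (hc : 0 ≤ c)
    (h : c * ∑ i, ∑ j, a i j ^ 2 ≤ 1 / 4) :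
    signAvg κ (fun s => Real.exp (c * ∑ i, (∑ j, sgn (s j) * a i j) ^ 2)) ≤ √2 := by
  set v : ι → ℝ := fun i => ∑ j, a i j ^ 2 with hv
  have hv0 : ∀ i, 0 ≤ v i := fun i => Finset.sum_nonneg fun j _ => sq_nonneg _
  set V := ∑ i, v i with hVdef
  rcases (Finset.sum_nonneg fun i (_ : i ∈ Finset.univ) => hv0 i).eq_or_lt with h0 | h0
  · have ha : ∀ i j, a i j = 0 := by
      intro i j
      have h1 := (Finset.sum_eq_zero_iff_of_nonneg fun i _ => hv0 i).1 h0.symm i (Finset.mem_univ i)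
      have h2 := (Finset.sum_eq_zero_iff_of_nonneg fun j _ => sq_nonneg (a i j)).1 h1 j
        (Finset.mem_univ j)
      exact pow_eq_zero_iff (two_ne_zero) |>.1 h2
    refine signAvg_le_of_le fun s => ?_
    simp only [ha]
    simp
  · have hw : ∑ i, v i / V = 1 := by rw [← Finset.sum_div, div_self h0.ne']
    -- Convexity of `exp` with weights `v i / V`. The coefficient `c * V / v i` is chosen so that
    -- each row separately meets the condition `c * V ≤ 1 / 4`.
    have key : ∀ s : κ → ℤˣ, Real.exp (c * ∑ i, (∑ j, sgn (s j) * a i j) ^ 2) ≤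
        ∑ i, v i / V * Real.exp (c * V / v i * (∑ j, sgn (s j) * a i j) ^ 2) := by
      intro s
      have := convexOn_exp.map_sum_le (t := Finset.univ) (w := fun i => v i / V)
        (p := fun i => c * V / v i * (∑ j, sgn (s j) * a i j) ^ 2)
        (fun i _ => div_nonneg (hv0 i) h0.le) hw (fun _ _ => Set.mem_univ _)
      refine (le_of_eq ?_).trans this
      congr 1
      rw [Finset.mul_sum]
      refine Finset.sum_congr rfl fun i _ => ?_
      -- If `v i = 0`, the division by zero is harmless because the whole row vanishes.
      rcases (hv0 i).eq_or_lt with hi | hi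
      · have : ∀ j, a i j = 0 := by
          intro j
          have h2 := (Finset.sum_eq_zero_iff_of_nonneg fun j _ => sq_nonneg (a i j)).1 hi.symm j
            (Finset.mem_univ j)
          exact pow_eq_zero_iff (two_ne_zero) |>.1 h2
        simp [this]
      · rw [smul_eq_mul]
        have : V ≠ 0 := h0.ne'
        field_simp
    refine (signAvg_mono key).trans ?_
    rw [signAvg_sum]
    calc _ ≤ ∑ i, v i / V * √2 := by
          refine Finset.sum_le_sum fun i _ => ?_
          rw [signAvg_const_mul]
          refine mul_le_mul_of_nonneg_left ?_ (div_nonneg (hv0 i) h0.le)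
          refine signAvg_exp_sq_le _ (div_nonneg (mul_nonneg hc h0.le) (hv0 i)) ?_
          refine le_trans ?_ h
          change c * V / v i * v i ≤ c * V
          rcases (hv0 i).eq_or_lt with hi | hi
          · rw [← hi]; simp; exact mul_nonneg hc h0.le
          · rw [div_mul_cancel₀ _ hi.ne']
      _ = √2 := by rw [← Finset.sum_mul, hw, one_mul]

/-- The expected maximum of decoupled Rademacher chaoses of order two. -/
theorem signAvg_chaos_norm_le [Nonempty T] (a : ι → κ → T → ℝ) {σ : ℝ} (hσ : 0 ≤ σ)
    (hV : ∀ t, ∑ i, ∑ j, a i j t ^ 2 ≤ σ ^ 2) :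
    signAvg κ (fun s' => signAvg ι fun s => ‖∑ i, ∑ j, (sgn (s i) * sgn (s' j)) • a i j‖) ≤
      √2 * σ * Real.log (4 * Fintype.card T) := by
  have hT : (0 : ℝ) < Fintype.card T := by exact_mod_cast Fintype.card_pos
  rcases hσ.eq_or_lt with rfl | hσ
  · have ha : ∀ i j t, a i j t = 0 := by
      intro i j t
      have h1 : ∑ i, ∑ j, a i j t ^ 2 ≤ 0 := by simpa using hV t
      have h3 : a i j t ^ 2 ≤ ∑ i, ∑ j, a i j t ^ 2 :=
        (Finset.single_le_sum (f := fun j => a i j t ^ 2) (fun _ _ => sq_nonneg _)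
          (Finset.mem_univ j)).trans
        (Finset.single_le_sum (f := fun i => ∑ j, a i j t ^ 2)
          (fun _ _ => Finset.sum_nonneg fun _ _ => sq_nonneg _) (Finset.mem_univ i))
      nlinarith [sq_nonneg (a i j t)]
    have ha' : ∀ i j, a i j = 0 := fun i j => funext fun t => ha i j t
    simp [ha', signAvg_const]
  -- Averaging over `s` leaves `2 * exp (l ^ 2 / 2 * ∑ ...)`, a square-exponential in `s'`. This `l`
  -- makes `l ^ 2 / 2 * σ ^ 2 = 1 / 4`, the threshold of `signAvg_exp_sum_sq_le`. The total is then
  -- `2 * √2 ≤ 4`, whence the 4 in `K`.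
  set l : ℝ := (√2 * σ)⁻¹ with hl
  have hl0 : 0 < l := by positivity
  have hl2 : l ^ 2 * σ ^ 2 = 1 / 2 := by
    rw [hl, inv_pow, mul_pow, Real.sq_sqrt (by norm_num)]
    field_simp
  set K : ℝ := 4 * Fintype.card T with hKdef
  have hK : 0 < K := by positivity
  have h1 : l * signAvg κ (fun s' => signAvg ι fun s =>
      ‖∑ i, ∑ j, (sgn (s i) * sgn (s' j)) • a i j‖) ≤ Real.log K := by
    rw [← signAvg_const_mul]
    simp_rw [← signAvg_const_mul]
    refine (signAvg_mono fun s' => signAvg_mono fun s =>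
      norm_le_log_add_sum_exp _ hK).trans ?_
    simp_rw [signAvg_add, signAvg_const, signAvg_const_mul, signAvg_sum]
    have : ∀ t, signAvg κ (fun s' => signAvg ι (fun s =>
        Real.exp (l * |(∑ i, ∑ j, (sgn (s i) * sgn (s' j)) • a i j) t|))) ≤ 4 := by
      intro t
      have e : ∀ (s : ι → ℤˣ) (s' : κ → ℤˣ),
          l * |(∑ i, ∑ j, (sgn (s i) * sgn (s' j)) • a i j) t| =
          |∑ i, sgn (s i) * (l * ∑ j, sgn (s' j) * a i j t)| := by
        intro s s'
        rw [← abs_of_pos hl0, ← abs_mul, abs_of_pos hl0, Finset.sum_apply, Finset.mul_sum]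
        congr 1
        refine Finset.sum_congr rfl fun i _ => ?_
        rw [Finset.sum_apply, Finset.mul_sum, Finset.mul_sum, Finset.mul_sum]
        refine Finset.sum_congr rfl fun j _ => ?_
        simp; ring
      simp_rw [e]
      refine (signAvg_mono fun s' => signAvg_exp_abs_le _).trans ?_
      rw [signAvg_const_mul]
      have h2 := signAvg_exp_sum_sq_le (fun i j => a i j t) (c := l ^ 2 / 2) (by positivity) (by
        have := mul_le_mul_of_nonneg_left (hV t) (sq_nonneg l)
        linarith)
      have h3 : √(2 : ℝ) ≤ 2 := by
        rw [Real.sqrt_le_left (by norm_num)]; norm_num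
      have h4 : signAvg κ (fun s' => Real.exp ((∑ i, (l * ∑ j, sgn (s' j) * a i j t) ^ 2) / 2)) =
          signAvg κ (fun s' => Real.exp (l ^ 2 / 2 * ∑ i, (∑ j, sgn (s' j) * a i j t) ^ 2)) := by
        congr 1
        ext s'
        simp_rw [mul_pow]
        rw [← Finset.mul_sum]
        ring_nf
      rw [h4]
      linarith
    have h2 := Finset.sum_le_sum fun t (_ : t ∈ Finset.univ) => this t
    rw [Finset.sum_const, Finset.card_univ, nsmul_eq_mul] at h2
    have h3 : K⁻¹ * ∑ t, signAvg κ (fun s' => signAvg ι (fun s =>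
        Real.exp (l * |(∑ i, ∑ j, (sgn (s i) * sgn (s' j)) • a i j) t|))) ≤ 1 := by
      rw [inv_mul_le_iff₀ hK, mul_one]
      refine h2.trans_eq ?_
      rw [hKdef]; ring
    linarith
  rw [hl, inv_mul_le_iff₀ (by positivity)] at h1
  exact h1

end Signs

/-! ### Symmetrization and a maximal inequality for i.i.d. sums. -/

section Expectation

variable {ι κ T E : Type*} [Fintype ι] [Fintype κ] [Fintype T] [MeasurableSpace E]

theorem enorm_pi_eq_iSup {V : Type*} [SeminormedAddCommGroup V] (v : ι → V) :
    ‖v‖ₑ = ⨆ i, ‖v i‖ₑ := by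
  rw [← edist_zero_right, edist_pi_def, Finset.sup_univ_eq_iSup]
  simp

theorem enorm_apply_le {V : Type*} [SeminormedAddCommGroup V] (v : ι → V) (i : ι) :
    ‖v i‖ₑ ≤ ‖v‖ₑ := by
  rw [enorm_pi_eq_iSup v]
  exact le_iSup (fun i => ‖v i‖ₑ) i

theorem enorm_sgn_smul {V : Type*} [NormedAddCommGroup V] [NormedSpace ℝ V] (u : ℤˣ) (v : V) :
    ‖sgn u • v‖ₑ = ‖v‖ₑ := by
  rcases Int.units_eq_one_or u with rfl | rfl <;> simp [sgn]

/-- Adding an independent centred summand does not decrease the expected norm. -/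
theorem lintegral_enorm_le_lintegral_enorm_add {α β V : Type*} [MeasurableSpace α]
    [MeasurableSpace β] [NormedAddCommGroup V] [NormedSpace ℝ V] [CompleteSpace V]
    (μ : Measure α) (ν : Measure β) [IsProbabilityMeasure ν] (Z : α → V) {W : β → V}
    (hW : Integrable W ν) (hW0 : ∫ b, W b ∂ν = 0) :
    ∫⁻ a, ‖Z a‖ₑ ∂μ ≤ ∫⁻ a, ∫⁻ b, ‖Z a + W b‖ₑ ∂ν ∂μ := by
  refine lintegral_mono fun a => ?_
  have : Z a = ∫ b, (Z a + W b) ∂ν := by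
    rw [integral_add (integrable_const _) hW, hW0]
    simp
  calc ‖Z a‖ₑ = ‖∫ b, (Z a + W b) ∂ν‖ₑ := by rw [← this]
    _ ≤ _ := enorm_integral_le_lintegral_enorm _

theorem integrable_sum_eval {V : Type*} [NormedAddCommGroup V]
    (F : Measure E) [IsProbabilityMeasure F] {g : E → V} (hg : Integrable g F) :
    Integrable (fun x : ι → E => ∑ i, g (x i)) (Measure.pi fun _ => F) :=
  integrable_finsetSum _ fun i _ =>
    (measurePreserving_eval (fun _ : ι => F) i).integrable_comp_of_integrable hg

theorem integral_sum_eval {V : Type*} [NormedAddCommGroup V] [NormedSpace ℝ V]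
    (F : Measure E) [IsProbabilityMeasure F] {g : E → V} (hg : Integrable g F)
    (hg0 : ∫ e, g e ∂F = 0) :
    ∫ x : ι → E, ∑ i, g (x i) ∂(Measure.pi fun _ => F) = 0 := by
  rw [integral_finsetSum (f := fun i (x : ι → E) => g (x i)) _ fun i _ =>
    (measurePreserving_eval (fun _ : ι => F) i).integrable_comp_of_integrable hg]
  refine Finset.sum_eq_zero fun i _ => ?_
  have h := measurePreserving_eval (fun _ : ι => F) i
  have h2 := integral_map (μ := Measure.pi fun _ : ι => F) h.measurable.aemeasurable
    (f := g) (by rw [h.map_eq]; exact hg.aestronglyMeasurable)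
  rw [h.map_eq, hg0] at h2
  exact h2.symm

/-- Symmetrization with a fixed sign pattern. -/
theorem lintegral_enorm_sum_le_two_mul_sgn (F : Measure E) [IsProbabilityMeasure F]
    {g : E → T → ℝ} (hgm : Measurable g) (hg : Integrable g F) (hg0 : ∫ e, g e ∂F = 0)
    (s : ι → ℤˣ) :
    ∫⁻ x : ι → E, ‖∑ i, g (x i)‖ₑ ∂(Measure.pi fun _ => F) ≤
      2 * ∫⁻ x : ι → E, ‖∑ i, sgn (s i) • g (x i)‖ₑ ∂(Measure.pi fun _ => F) := by
  classical
  -- Grouping indices by sign turns the two sums into `A + B` and `A - B` with `A`, `B` independent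
  -- and centred. Each of `E ‖A‖`, `E ‖B‖` is at most `E ‖A - B‖`.
  set q : ι → Prop := fun i => s i = 1 with hq
  have hmp := measurePreserving_piEquivPiSubtypeProd (fun _ : ι => F) q
  set A : ({i // q i} → E) → T → ℝ := fun u => ∑ i, g (u i) with hA
  set B : ({i // ¬ q i} → E) → T → ℝ := fun u => ∑ i, g (u i) with hB
  have hAm : Measurable A := by fun_prop
  have hBm : Measurable B := by fun_prop
  have e1 : ∀ x : ι → E, ∑ i, g (x i) =
      A (MeasurableEquiv.piEquivPiSubtypeProd (fun _ => E) q x).1 +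
        B (MeasurableEquiv.piEquivPiSubtypeProd (fun _ => E) q x).2 := by
    intro x
    exact (Fintype.sum_subtype_add_sum_subtype q fun i => g (x i)).symm
  have e2 : ∀ x : ι → E, ∑ i, sgn (s i) • g (x i) =
      A (MeasurableEquiv.piEquivPiSubtypeProd (fun _ => E) q x).1 -
        B (MeasurableEquiv.piEquivPiSubtypeProd (fun _ => E) q x).2 := by
    intro x
    rw [← Fintype.sum_subtype_add_sum_subtype q fun i => sgn (s i) • g (x i), sub_eq_add_neg]
    congr 1
    · refine Finset.sum_congr rfl fun i _ => ?_
      have : s i = 1 := i.2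
      rw [this]
      simp [sgn, MeasurableEquiv.piEquivPiSubtypeProd]
    · rw [hB, ← Finset.sum_neg_distrib]
      refine Finset.sum_congr rfl fun i _ => ?_
      have : s i = -1 := (Int.units_eq_one_or _).resolve_left i.2
      rw [this]
      simp [sgn, MeasurableEquiv.piEquivPiSubtypeProd]
  simp_rw [e1, e2]
  have t1 := hmp.lintegral_comp (f := fun z => ‖A z.1 + B z.2‖ₑ) (by fun_prop)
  have t2 := hmp.lintegral_comp (f := fun z => ‖A z.1 - B z.2‖ₑ) (by fun_prop)
  rw [t1, t2]
  set μ := Measure.pi fun _ : {i // q i} => F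
  set ν := Measure.pi fun _ : {i // ¬ q i} => F
  have hAi : Integrable A μ := integrable_sum_eval F hg
  have hBi : Integrable B ν := integrable_sum_eval F hg
  have hA0 : ∫ a, A a ∂μ = 0 := integral_sum_eval F hg hg0
  have hB0 : ∫ a, B a ∂ν = 0 := integral_sum_eval F hg hg0
  have b1 : ∫⁻ z, ‖A z.1‖ₑ ∂(μ.prod ν) ≤ ∫⁻ z, ‖A z.1 - B z.2‖ₑ ∂(μ.prod ν) := by
    rw [lintegral_prod _ (by fun_prop), lintegral_prod _ (by fun_prop)]
    simp only [lintegral_const, measure_univ, mul_one]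
    refine (lintegral_enorm_le_lintegral_enorm_add μ ν A hBi.neg (by
      simp only [Pi.neg_apply]; rw [integral_neg, hB0, neg_zero])).trans_eq ?_
    simp [sub_eq_add_neg]
  have b2 : ∫⁻ z, ‖B z.2‖ₑ ∂(μ.prod ν) ≤ ∫⁻ z, ‖A z.1 - B z.2‖ₑ ∂(μ.prod ν) := by
    rw [lintegral_prod_symm _ (by fun_prop), lintegral_prod_symm _ (by fun_prop)]
    simp only [lintegral_const, measure_univ, mul_one]
    refine (lintegral_enorm_le_lintegral_enorm_add ν μ B hAi.neg (by
      simp only [Pi.neg_apply]; rw [integral_neg, hA0, neg_zero])).trans_eq ?_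
    refine lintegral_congr fun a => lintegral_congr fun b => ?_
    rw [← enorm_neg]
    congr 1
    simp only [Pi.neg_apply]
    abel
  calc _ ≤ ∫⁻ z, (‖A z.1‖ₑ + ‖B z.2‖ₑ) ∂(μ.prod ν) := lintegral_mono fun z => enorm_add_le _ _
    _ = ∫⁻ z, ‖A z.1‖ₑ ∂(μ.prod ν) + ∫⁻ z, ‖B z.2‖ₑ ∂(μ.prod ν) :=
        lintegral_add_left (by fun_prop) _
    _ ≤ _ := by rw [two_mul]; exact add_le_add b1 b2

/-- A bound that holds for every sign pattern holds for the average over sign patterns. -/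
theorem le_lintegral_signAvg {α : Type*} [MeasurableSpace α] {μ : Measure α}
    {ψ : (ι → ℤˣ) → α → ℝ} (hm : ∀ s, Measurable (ψ s)) (h0 : ∀ s x, 0 ≤ ψ s x) {C : ℝ≥0∞}
    (h : ∀ s, C ≤ ∫⁻ x, ENNReal.ofReal (ψ s x) ∂μ) :
    C ≤ ∫⁻ x, ENNReal.ofReal (signAvg ι fun s => ψ s x) ∂μ := by
  classical
  set N : ℝ≥0∞ := 2 ^ Fintype.card ι with hN
  have hN0 : N ≠ 0 := by positivity
  have hNt : N ≠ ∞ := by simp [hN]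
  have e : ∀ x, ENNReal.ofReal (signAvg ι fun s => ψ s x) =
      N⁻¹ * ∑ s, ENNReal.ofReal (ψ s x) := by
    intro x
    unfold signAvg
    rw [ENNReal.ofReal_div_of_pos (by positivity), ENNReal.ofReal_sum_of_nonneg fun s _ => h0 s x,
      ENNReal.div_eq_inv_mul, ENNReal.ofReal_pow (by norm_num)]
    simp [hN]
  simp_rw [e]
  rw [lintegral_const_mul _ (by fun_prop), lintegral_finsetSum _ (fun s _ => by fun_prop)]
  have := Finset.sum_le_sum fun s (_ : s ∈ Finset.univ) => h s
  rw [Finset.sum_const, Finset.card_univ, card_signs, nsmul_eq_mul] at this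
  calc C = N⁻¹ * (N * C) := by rw [← mul_assoc, ENNReal.inv_mul_cancel hN0 hNt, one_mul]
    _ ≤ _ := by
      gcongr
      simpa [hN] using this

theorem log_two_mul_card_nonneg [Nonempty T] : 0 ≤ Real.log (2 * Fintype.card T) := by
  have : (1 : ℝ) ≤ Fintype.card T := by exact_mod_cast Fintype.card_pos
  exact Real.log_nonneg (by linarith)

/-- Signed sums of nonnegative vectors: the average maximum, after absorbing. -/
theorem signAvg_norm_le_of_nonneg [Nonempty T] (a : ι → T → ℝ) (ha : ∀ i t, 0 ≤ a i t) :
    signAvg ι (fun s => ‖∑ i, sgn (s i) • a i‖) ≤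
      2 * Real.log (2 * Fintype.card T) * ‖a‖ + ‖∑ i, a i‖ / 4 := by
  rcases (norm_nonneg a).eq_or_lt with h0 | h0
  · have : a = 0 := norm_eq_zero.1 h0.symm
    subst this
    simp [signAvg_const]
  · have h1 := signAvg_norm_le a (V := ‖a‖ * ‖∑ i, a i‖) (l := (2 * ‖a‖)⁻¹) (by positivity) (by
      intro t
      calc ∑ i, a i t ^ 2 ≤ ∑ i, ‖a‖ * a i t := by
            refine Finset.sum_le_sum fun i _ => ?_
            rw [sq]
            refine mul_le_mul_of_nonneg_right ?_ (ha i t)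
            exact (le_abs_self _).trans ((norm_le_pi_norm (a i) t).trans (norm_le_pi_norm a i))
        _ = ‖a‖ * (∑ i, a i) t := by rw [← Finset.mul_sum, Finset.sum_apply]
        _ ≤ _ := by
          gcongr
          exact (le_abs_self _).trans (norm_le_pi_norm (∑ i, a i) t))
    refine h1.trans_eq ?_
    field_simp
    ring

theorem enorm_integral_le_iSup {g : E → T → ℝ} {F : Measure E} (hg : Integrable g F) :
    ‖∫ e, g e ∂F‖ₑ ≤ ⨆ t, ∫⁻ e, ‖g e t‖ₑ ∂F := by
  rw [enorm_pi_eq_iSup]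
  refine iSup_mono fun t => ?_
  rw [eval_integral fun t => hg.eval t]
  exact enorm_integral_le_lintegral_enorm _

/-- Finiteness of `a` is what permits cancelling `a / 2` in `[0, ∞]`. -/
theorem self_bound_ennreal {a A B : ℝ≥0∞} (ha : a ≠ ∞) (h : a ≤ A + B + a / 2) :
    a ≤ 2 * A + 2 * B := by
  have h2 : a / 2 ≠ ∞ := (ENNReal.div_lt_top ha (by norm_num)).ne
  have h3 : a / 2 + a / 2 ≤ (A + B) + a / 2 := by rwa [ENNReal.add_halves]
  have h4 : a / 2 ≤ A + B := (ENNReal.add_le_add_iff_right h2).1 h3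
  calc a = a / 2 + a / 2 := (ENNReal.add_halves a).symm
    _ ≤ (A + B) + (A + B) := add_le_add h4 h4
    _ = _ := by ring

/-- Maximal inequality for sums of i.i.d. nonnegative vectors, integrable case. -/
theorem lintegral_enorm_sum_le_of_integrable [Nonempty T] (F : Measure E) [IsProbabilityMeasure F]
    {g : E → T → ℝ} (hgm : Measurable g) (hg : Integrable g F) (hg0 : ∀ e t, 0 ≤ g e t) :
    ∫⁻ x : ι → E, ‖∑ i, g (x i)‖ₑ ∂(Measure.pi fun _ => F) ≤
      6 * Fintype.card ι * (⨆ t, ∫⁻ e, ‖g e t‖ₑ ∂F) +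
      8 * ENNReal.ofReal (Real.log (2 * Fintype.card T)) *
        ∫⁻ x : ι → E, ‖fun i => g (x i)‖ₑ ∂(Measure.pi fun _ => F) := by
  set μ := Measure.pi fun _ : ι => F with hμ
  set L := Real.log (2 * Fintype.card T) with hL
  have hL0 : 0 ≤ L := log_two_mul_card_nonneg
  set D := ⨆ t, ∫⁻ e, ‖g e t‖ₑ ∂F with hD
  set n : ℝ≥0∞ := (Fintype.card ι : ℝ≥0∞) with hn
  set A := ∫⁻ x : ι → E, ‖∑ i, g (x i)‖ₑ ∂μ with hA
  set m := ∫ e, g e ∂F with hm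
  have hmD : ‖m‖ₑ ≤ D := enorm_integral_le_iSup hg
  have hAt : A ≠ ∞ := (integrable_sum_eval F hg).2.ne
  have hsum : ∀ u : ι → T → ℝ, (∀ i, ‖u i‖ₑ ≤ ‖m‖ₑ) → ‖∑ i, u i‖ₑ ≤ n * D := by
    intro u hu
    calc ‖∑ i, u i‖ₑ ≤ ∑ i, ‖u i‖ₑ := enorm_sum_le _ _
      _ ≤ ∑ _i : ι, D := Finset.sum_le_sum fun i _ => (hu i).trans hmD
      _ = n * D := by simp [hn]
  -- Centring costs `n * D` once, and removing the mean from the signed sum costs it twice more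
  -- because of the symmetrization factor 2.
  have hs : ∀ s : ι → ℤˣ, A ≤ 3 * n * D + 2 * ∫⁻ x, ‖∑ i, sgn (s i) • g (x i)‖ₑ ∂μ := by
    intro s
    have h1 := lintegral_enorm_sum_le_two_mul_sgn F (g := fun e => g e - m) (by fun_prop)
      (hg.sub (integrable_const m)) (by
        rw [integral_sub hg (integrable_const m)]; simp [hm]) s
    calc A ≤ ∫⁻ x, (‖∑ i, (g (x i) - m)‖ₑ + n * D) ∂μ := by
          refine lintegral_mono fun x => ?_
          have : ∑ i, g (x i) = ∑ i, (g (x i) - m) + ∑ _i : ι, m := by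
            rw [← Finset.sum_add_distrib]; simp
          rw [this]
          exact (enorm_add_le _ _).trans (add_le_add le_rfl (hsum _ fun _ => le_rfl))
      _ = ∫⁻ x, ‖∑ i, (g (x i) - m)‖ₑ ∂μ + n * D := by
          rw [lintegral_add_right _ measurable_const]; simp
      _ ≤ 2 * (∫⁻ x, ‖∑ i, sgn (s i) • (g (x i) - m)‖ₑ ∂μ) + n * D := by gcongr
      _ ≤ 2 * (∫⁻ x, (‖∑ i, sgn (s i) • g (x i)‖ₑ + n * D) ∂μ) + n * D := by
          gcongr with x
          have : ∑ i, sgn (s i) • (g (x i) - m) =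
              ∑ i, sgn (s i) • g (x i) - ∑ i, sgn (s i) • m := by
            rw [← Finset.sum_sub_distrib]; simp [smul_sub]
          rw [this]
          exact (enorm_sub_le).trans
            (add_le_add le_rfl (hsum _ fun i => (enorm_sgn_smul _ _).le))
      _ = _ := by
          rw [lintegral_add_right _ measurable_const]; simp; ring
  have havg : A ≤ 3 * n * D + 2 * ∫⁻ x, ENNReal.ofReal
      (signAvg ι fun s => ‖∑ i, sgn (s i) • g (x i)‖) ∂μ := by
    have h1 : ∀ s : ι → ℤˣ, (A - 3 * n * D) / 2 ≤
        ∫⁻ x, ENNReal.ofReal ‖∑ i, sgn (s i) • g (x i)‖ ∂μ := by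
      intro s
      simp_rw [ofReal_norm]
      rw [ENNReal.div_le_iff (by norm_num) (by norm_num), tsub_le_iff_left, mul_comm _ 2]
      exact hs s
    have h2 := le_lintegral_signAvg (fun s => by fun_prop) (fun s x => norm_nonneg _) h1
    rw [ENNReal.div_le_iff (by norm_num) (by norm_num), tsub_le_iff_left, mul_comm _ 2] at h2
    exact h2
  have hfin : A ≤ 3 * n * D + 4 * ENNReal.ofReal L * (∫⁻ x, ‖fun i => g (x i)‖ₑ ∂μ) + A / 2 := by
    refine havg.trans ?_
    rw [add_assoc]
    refine add_le_add le_rfl ?_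
    calc _ ≤ 2 * ∫⁻ x, (2 * ENNReal.ofReal L * ‖fun i => g (x i)‖ₑ +
            4⁻¹ * ‖∑ i, g (x i)‖ₑ) ∂μ := by
          gcongr with x
          refine (ENNReal.ofReal_le_ofReal (signAvg_norm_le_of_nonneg (fun i => g (x i))
            fun i t => hg0 _ t)).trans_eq ?_
          rw [ENNReal.ofReal_add (by positivity) (by positivity),
            ENNReal.ofReal_mul (by positivity), ENNReal.ofReal_mul (by positivity),
            ofReal_norm, ENNReal.ofReal_div_of_pos (by norm_num), ofReal_norm,
            ENNReal.div_eq_inv_mul]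
          simp [hL]
      _ = _ := by
          rw [lintegral_add_right _ (by fun_prop), lintegral_const_mul' _ _ (by finiteness),
            lintegral_const_mul' _ _ (by finiteness), mul_add, ENNReal.div_eq_inv_mul]
          congr 1
          · ring
          · rw [← mul_assoc]
            congr 1
            rw [show (4 : ℝ≥0∞) = 2 * 2 by norm_num, ENNReal.mul_inv (by simp) (by simp),
              ← mul_assoc, ENNReal.mul_inv_cancel (by simp) (by simp), one_mul]
  refine (self_bound_ennreal hAt hfin).trans_eq ?_
  ring

/-- Maximal inequality for sums of i.i.d. nonnegative vectors. -/
theorem lintegral_iSup_sum_le [Nonempty T] (F : Measure E) [IsProbabilityMeasure F]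
    {r : E → T → ℝ≥0∞} (hr : Measurable r) :
    ∫⁻ x : ι → E, ⨆ t, ∑ i, r (x i) t ∂(Measure.pi fun _ => F) ≤
      6 * Fintype.card ι * (⨆ t, ∫⁻ e, r e t ∂F) +
      8 * ENNReal.ofReal (Real.log (2 * Fintype.card T)) *
        ∫⁻ x : ι → E, ⨆ i, ⨆ t, r (x i) t ∂(Measure.pi fun _ => F) := by
  rcases isEmpty_or_nonempty ι with hι | hι
  · simp
  by_cases hfin : ∀ t, ∫⁻ e, r e t ∂F ≠ ∞
  · set g : E → T → ℝ := fun e t => (r e t).toReal with hgdef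
    have hrt : ∀ t, Measurable fun e => r e t := fun t => by fun_prop
    have hgm : Measurable g := measurable_pi_iff.2 fun t => (hrt t).ennreal_toReal
    have hae : ∀ᵐ e ∂F, ∀ t, ‖g e t‖ₑ = r e t := by
      rw [ae_all_iff]
      intro t
      filter_upwards [ae_lt_top (hrt t) (hfin t)] with e he
      rw [hgdef, Real.enorm_of_nonneg ENNReal.toReal_nonneg, ENNReal.ofReal_toReal he.ne]
    have hg : Integrable g F := by
      refine Integrable.of_eval fun t => ?_
      exact integrable_toReal_of_lintegral_ne_top (hrt t).aemeasurable (hfin t)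
    have hpi : ∀ᵐ x : ι → E ∂(Measure.pi fun _ => F), ∀ i t, ‖g (x i) t‖ₑ = r (x i) t := by
      rw [ae_all_iff]
      intro i
      exact (Measure.tendsto_eval_ae_ae (μ := fun _ : ι => F) (i := i)).eventually hae
    have h := lintegral_enorm_sum_le_of_integrable (ι := ι) F hgm hg
      fun e t => ENNReal.toReal_nonneg
    refine le_trans (le_of_eq ?_) (h.trans_eq ?_)
    · refine lintegral_congr_ae ?_
      filter_upwards [hpi] with x hx
      rw [enorm_pi_eq_iSup]
      refine iSup_congr fun t => ?_
      rw [Finset.sum_apply, Real.enorm_of_nonneg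
        (Finset.sum_nonneg fun i _ => ENNReal.toReal_nonneg),
        ENNReal.ofReal_sum_of_nonneg fun i _ => ENNReal.toReal_nonneg]
      refine Finset.sum_congr rfl fun i _ => ?_
      have := hx i t
      rw [Real.enorm_of_nonneg ENNReal.toReal_nonneg] at this
      exact this.symm
    · congr 2
      · refine iSup_congr fun t => lintegral_congr_ae ?_
        filter_upwards [hae] with e he using he t
      · refine lintegral_congr_ae ?_
        filter_upwards [hpi] with x hx
        simp_rw [enorm_pi_eq_iSup, hx]
  · push Not at hfin
    obtain ⟨t, ht⟩ := hfin
    have : (⨆ t, ∫⁻ e, r e t ∂F) = ∞ := top_unique (ht ▸ le_iSup (fun t => ∫⁻ e, r e t ∂F) t)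
    -- The coefficient of the infinite mean is nonzero because `ι` is nonempty here, so the right
    -- side is `∞`.
    rw [this, ENNReal.mul_top (by simp), top_add]
    exact le_top

end Expectation

/-! ### Decoupled canonical sums of two independent samples. -/

section Bilinear

variable {ι κ T E : Type*} [Fintype ι] [Fintype κ] [Fintype T] [MeasurableSpace E]

/-- The array of squared entries of a decoupled kernel array is dominated by the squared
maximum of the array. -/
theorem enorm_sq_apply_le (a : ι → κ → T → ℝ) (i : ι) (j : κ) (t : T) :
    ‖a i j t‖ₑ ^ 2 ≤ ‖a‖ₑ ^ 2 := by
  gcongr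
  exact (enorm_apply_le _ t).trans ((enorm_apply_le _ j).trans (enorm_apply_le _ i))

/-- The expected maximal sum of squares of a decoupled array. -/
theorem lintegral_iSup_sum_sq_le [Nonempty T] (F : Measure E) [IsProbabilityMeasure F]
    {h : E → E → T → ℝ} (hm : Measurable fun z : E × E => h z.1 z.2) :
    ∫⁻ y : κ → E, ∫⁻ x : ι → E, ⨆ t, ∑ i, ∑ j, ‖h (x i) (y j) t‖ₑ ^ 2
        ∂(Measure.pi fun _ => F) ∂(Measure.pi fun _ => F) ≤
      36 * Fintype.card ι * Fintype.card κ * (⨆ t, ∫⁻ y, ∫⁻ x, ‖h x y t‖ₑ ^ 2 ∂F ∂F) +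
      (48 * Fintype.card ι + 8 * Fintype.card κ) *
        ENNReal.ofReal (Real.log (2 * Fintype.card T)) *
        ∫⁻ y : κ → E, ∫⁻ x : ι → E, ‖fun i j => h (x i) (y j)‖ₑ ^ 2
          ∂(Measure.pi fun _ => F) ∂(Measure.pi fun _ => F) := by
  rcases isEmpty_or_nonempty ι with hι | hι
  · simp
  obtain ⟨i₀⟩ := hι
  set μ := Measure.pi fun _ : ι => F
  set ν := Measure.pi fun _ : κ => F
  set L := ENNReal.ofReal (Real.log (2 * Fintype.card T))
  have hmt : ∀ t, Measurable fun z : E × E => h z.1 z.2 t := fun t => by fun_prop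
  have hm1 : ∀ y t, Measurable fun x => h x y t := fun y t =>
    (hmt t).comp (measurable_id.prodMk measurable_const)
  have hmM : Measurable fun z : (κ → E) × (ι → E) => ‖fun i j => h (z.2 i) (z.1 j)‖ₑ ^ 2 := by
    refine Measurable.pow_const (Measurable.enorm ?_) _
    refine measurable_pi_iff.2 fun i => measurable_pi_iff.2 fun j => ?_
    exact hm.comp (f := fun z : (κ → E) × (ι → E) => (z.2 i, z.1 j)) (by fun_prop)
  set r : E → T → ℝ≥0∞ := fun y t => ∫⁻ x, ‖h x y t‖ₑ ^ 2 ∂F with hr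
  have hrm : Measurable r := by
    refine measurable_pi_iff.2 fun t => ?_
    exact Measurable.lintegral_prod_left' (f := fun z : E × E => ‖h z.1 z.2 t‖ₑ ^ 2)
      (by fun_prop)
  -- With `y` fixed, the maximal inequality is applied to the row sums over `j`, each at most
  -- `Fintype.card κ` times the squared maximum. Their means `∑ j, r (y j) t` are again nonnegative
  -- i.i.d. sums, to which it is applied a second time.
  have hstep : ∀ y : κ → E, ∫⁻ x : ι → E, ⨆ t, ∑ i, ∑ j, ‖h (x i) (y j) t‖ₑ ^ 2 ∂μ ≤
      6 * Fintype.card ι * (⨆ t, ∑ j, r (y j) t) +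
        8 * L * (Fintype.card κ * ∫⁻ x : ι → E, ‖fun i j => h (x i) (y j)‖ₑ ^ 2 ∂μ) := by
    intro y
    have h1 := lintegral_iSup_sum_le (ι := ι) F
      (r := fun x t => ∑ j, ‖h x (y j) t‖ₑ ^ 2) (by
        refine measurable_pi_iff.2 fun t => Finset.measurable_sum _ fun j _ => ?_
        exact (hm1 (y j) t).enorm.pow_const _)
    refine h1.trans ?_
    gcongr with t
    · rw [lintegral_finsetSum _ fun j _ => (hm1 (y j) t).enorm.pow_const _]
    · rw [← lintegral_const_mul' _ _ (by finiteness)]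
      refine lintegral_mono fun x => iSup_le fun i => iSup_le fun t => ?_
      refine (Finset.sum_le_sum fun j _ => enorm_sq_apply_le (fun i j => h (x i) (y j)) i j t).trans
        ?_
      simp
  have hrM : ∀ y : κ → E, ⨆ j, ⨆ t, r (y j) t ≤
      ∫⁻ x : ι → E, ‖fun i j => h (x i) (y j)‖ₑ ^ 2 ∂μ := by
    intro y
    refine iSup_le fun j => iSup_le fun t => ?_
    have e := (measurePreserving_eval (fun _ : ι => F) i₀).lintegral_comp
      (f := fun x => ‖h x (y j) t‖ₑ ^ 2) ((hm1 (y j) t).enorm.pow_const _)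
    rw [hr]
    simp only
    rw [← e]
    exact lintegral_mono fun x => enorm_sq_apply_le (fun i j => h (x i) (y j)) i₀ j t
  have h2 := lintegral_iSup_sum_le (ι := κ) F hrm
  calc _ ≤ ∫⁻ y : κ → E, (6 * Fintype.card ι * (⨆ t, ∑ j, r (y j) t) +
        8 * L * (Fintype.card κ * ∫⁻ x : ι → E, ‖fun i j => h (x i) (y j)‖ₑ ^ 2 ∂μ)) ∂ν :=
        lintegral_mono hstep
    _ = 6 * Fintype.card ι * (∫⁻ y : κ → E, ⨆ t, ∑ j, r (y j) t ∂ν) +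
        8 * L * (Fintype.card κ *
          ∫⁻ y : κ → E, ∫⁻ x : ι → E, ‖fun i j => h (x i) (y j)‖ₑ ^ 2 ∂μ ∂ν) := by
      rw [lintegral_add_right _ (by
          exact (hmM.lintegral_prod_right').const_mul _ |>.const_mul _),
        lintegral_const_mul' _ _ (by finiteness), lintegral_const_mul' _ _ (by finiteness),
        lintegral_const_mul' _ _ (by finiteness)]
    _ ≤ 6 * Fintype.card ι * (6 * Fintype.card κ * (⨆ t, ∫⁻ e, r e t ∂F) + 8 * L *
          ∫⁻ y : κ → E, ∫⁻ x : ι → E, ‖fun i j => h (x i) (y j)‖ₑ ^ 2 ∂μ ∂ν) +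
        8 * L * (Fintype.card κ *
          ∫⁻ y : κ → E, ∫⁻ x : ι → E, ‖fun i j => h (x i) (y j)‖ₑ ^ 2 ∂μ ∂ν) := by
      gcongr
      exact h2.trans (by gcongr; exact hrM _)
    _ = _ := by ring

/-- Symmetrization of a decoupled canonical sum with fixed sign patterns. -/
theorem lintegral_enorm_bilinear_le_sgn (F : Measure E) [IsProbabilityMeasure F]
    {h : E → E → T → ℝ} (hm : Measurable fun z : E × E => h z.1 z.2)
    (hl : ∀ x, Integrable (fun y => h x y) F) (hl0 : ∀ x, ∫ y, h x y ∂F = 0)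
    (hr : ∀ y, Integrable (fun x => h x y) F) (hr0 : ∀ y, ∫ x, h x y ∂F = 0)
    (s : ι → ℤˣ) (s' : κ → ℤˣ) :
    ∫⁻ y : κ → E, ∫⁻ x : ι → E, ‖∑ i, ∑ j, h (x i) (y j)‖ₑ
        ∂(Measure.pi fun _ => F) ∂(Measure.pi fun _ => F) ≤
      4 * ∫⁻ y : κ → E, ∫⁻ x : ι → E, ‖∑ i, ∑ j, (sgn (s i) * sgn (s' j)) • h (x i) (y j)‖ₑ
        ∂(Measure.pi fun _ => F) ∂(Measure.pi fun _ => F) := by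
  have hmx : ∀ y, Measurable fun x => h x y := fun y =>
    hm.comp (measurable_id.prodMk measurable_const)
  have hmy : ∀ x, Measurable fun y => h x y := fun x =>
    hm.comp (measurable_const.prodMk measurable_id)
  have hij : ∀ i j, Measurable fun z : (κ → E) × (ι → E) => h (z.2 i) (z.1 j) := fun i j =>
    hm.comp (f := fun z : (κ → E) × (ι → E) => (z.2 i, z.1 j)) (by fun_prop)
  have h1 : ∀ y : κ → E, ∫⁻ x : ι → E, ‖∑ i, ∑ j, h (x i) (y j)‖ₑ ∂(Measure.pi fun _ => F) ≤
      2 * ∫⁻ x : ι → E, ‖∑ i, sgn (s i) • ∑ j, h (x i) (y j)‖ₑ ∂(Measure.pi fun _ => F) := by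
    intro y
    refine lintegral_enorm_sum_le_two_mul_sgn F (g := fun x => ∑ j, h x (y j))
      (Finset.measurable_sum _ fun j _ => hmx _) (integrable_finsetSum _ fun j _ => hr _) ?_ s
    rw [integral_finsetSum _ fun j _ => hr _]
    exact Finset.sum_eq_zero fun j _ => hr0 _
  -- After the `x`-signs are inserted, the sum is still centred in each `y j`. A second
  -- symmetrization therefore applies once the integrals are swapped.
  have h2 : ∀ x : ι → E, ∫⁻ y : κ → E, ‖∑ j, ∑ i, sgn (s i) • h (x i) (y j)‖ₑ
      ∂(Measure.pi fun _ => F) ≤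
      2 * ∫⁻ y : κ → E, ‖∑ j, sgn (s' j) • ∑ i, sgn (s i) • h (x i) (y j)‖ₑ
      ∂(Measure.pi fun _ => F) := by
    intro x
    refine lintegral_enorm_sum_le_two_mul_sgn F (g := fun y => ∑ i, sgn (s i) • h (x i) y)
      (Finset.measurable_sum _ fun i _ => (hmy _).fun_const_smul _)
      (integrable_finsetSum _ fun i _ => (hl _).fun_smul _) ?_ s'
    rw [integral_finsetSum _ fun i _ => (hl _).fun_smul _]
    refine Finset.sum_eq_zero fun i _ => ?_
    rw [integral_smul, hl0, smul_zero]
  calc _ ≤ ∫⁻ y : κ → E, 2 * ∫⁻ x : ι → E, ‖∑ i, sgn (s i) • ∑ j, h (x i) (y j)‖ₑ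
        ∂(Measure.pi fun _ => F) ∂(Measure.pi fun _ => F) := lintegral_mono h1
    _ = 2 * ∫⁻ x : ι → E, ∫⁻ y : κ → E, ‖∑ j, ∑ i, sgn (s i) • h (x i) (y j)‖ₑ
        ∂(Measure.pi fun _ => F) ∂(Measure.pi fun _ => F) := by
      rw [lintegral_const_mul' _ _ (by finiteness), lintegral_lintegral_swap (by
        refine Measurable.aemeasurable (Measurable.enorm ?_)
        exact Finset.measurable_sum _ fun i _ =>
          (Finset.measurable_sum _ fun j _ => hij i j).fun_const_smul _)]
      simp_rw [Finset.smul_sum]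
      congr 1
      refine lintegral_congr fun x => lintegral_congr fun y => ?_
      rw [Finset.sum_comm]
    _ ≤ 2 * ∫⁻ x : ι → E, 2 * ∫⁻ y : κ → E, ‖∑ j, sgn (s' j) • ∑ i, sgn (s i) • h (x i) (y j)‖ₑ
        ∂(Measure.pi fun _ => F) ∂(Measure.pi fun _ => F) := by
      gcongr with x
      exact h2 x
    _ = _ := by
      rw [lintegral_const_mul' _ _ (by finiteness), ← mul_assoc,
        show (2 : ℝ≥0∞) * 2 = 4 by norm_num, lintegral_lintegral_swap (by
        refine Measurable.aemeasurable (Measurable.enorm ?_)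
        refine Finset.measurable_sum _ fun j _ => Measurable.fun_const_smul
          (Finset.measurable_sum _ fun i _ => Measurable.fun_const_smul ?_ _) _
        exact hm.comp (f := fun z : (ι → E) × (κ → E) => (z.1 i, z.2 j)) (by fun_prop))]
      congr 1
      refine lintegral_congr fun y => lintegral_congr fun x => ?_
      simp_rw [Finset.smul_sum, smul_smul]
      rw [Finset.sum_comm]
      simp_rw [mul_comm]

theorem le_lintegral_prod_signAvg {α : Type*} [MeasurableSpace α] {μ : Measure α}
    {ψ : (ι → ℤˣ) → (κ → ℤˣ) → α → ℝ} (hm : ∀ s s', Measurable (ψ s s'))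
    (h0 : ∀ s s' x, 0 ≤ ψ s s' x) {C : ℝ≥0∞}
    (h : ∀ s s', C ≤ ∫⁻ x, ENNReal.ofReal (ψ s s' x) ∂μ) :
    C ≤ ∫⁻ x, ENNReal.ofReal (signAvg κ fun s' => signAvg ι fun s => ψ s s' x) ∂μ := by
  refine le_lintegral_signAvg (fun s' => ?_) (fun s' x => signAvg_nonneg fun s => h0 _ _ _)
    fun s' => le_lintegral_signAvg (fun s => hm s s') (fun s x => h0 s s' x) fun s => h s s'
  unfold signAvg
  exact (Finset.measurable_sum _ fun s _ => hm s s').div_const _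

/-- Cauchy–Schwarz against the constant 1, valid also for infinite integrals. -/
theorem lintegral_rpow_half_le {α : Type*} [MeasurableSpace α] (μ : Measure α)
    [IsProbabilityMeasure μ] {φ : α → ℝ≥0∞} (hφ : Measurable φ) :
    ∫⁻ x, φ x ^ (1 / 2 : ℝ) ∂μ ≤ (∫⁻ x, φ x ∂μ) ^ (1 / 2 : ℝ) := by
  have h := ENNReal.lintegral_mul_le_Lp_mul_Lq μ Real.HolderConjugate.two_two
    (f := fun x => φ x ^ (1 / 2 : ℝ)) (g := fun _ => 1) (by fun_prop) (by fun_prop)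
  have e : ∀ x, (φ x ^ (1 / 2 : ℝ)) ^ (2 : ℝ) = φ x := fun x => by
    rw [← ENNReal.rpow_mul]; norm_num
  simp only [e] at h
  simpa using h

/-- Maximal inequality for decoupled canonical sums, in terms of the sum of squares. -/
theorem lintegral_enorm_bilinear_le [Nonempty T] (F : Measure E) [IsProbabilityMeasure F]
    {h : E → E → T → ℝ} (hm : Measurable fun z : E × E => h z.1 z.2)
    (hl : ∀ x, Integrable (fun y => h x y) F) (hl0 : ∀ x, ∫ y, h x y ∂F = 0)
    (hr : ∀ y, Integrable (fun x => h x y) F) (hr0 : ∀ y, ∫ x, h x y ∂F = 0) :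
    ∫⁻ y : κ → E, ∫⁻ x : ι → E, ‖∑ i, ∑ j, h (x i) (y j)‖ₑ
        ∂(Measure.pi fun _ => F) ∂(Measure.pi fun _ => F) ≤
      4 * ENNReal.ofReal (√2 * Real.log (4 * Fintype.card T)) *
        (∫⁻ y : κ → E, ∫⁻ x : ι → E, ⨆ t, ∑ i, ∑ j, ‖h (x i) (y j) t‖ₑ ^ 2
        ∂(Measure.pi fun _ => F) ∂(Measure.pi fun _ => F)) ^ (1 / 2 : ℝ) := by
  set μ := Measure.pi fun _ : ι => F
  set ν := Measure.pi fun _ : κ => F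
  set L := Real.log (4 * Fintype.card T) with hL
  have hL0 : 0 ≤ L := by
    have : (1 : ℝ) ≤ Fintype.card T := by exact_mod_cast Fintype.card_pos
    exact Real.log_nonneg (by linarith)
  have hij : ∀ i j, Measurable fun z : (κ → E) × (ι → E) => h (z.2 i) (z.1 j) := fun i j =>
    hm.comp (f := fun z : (κ → E) × (ι → E) => (z.2 i, z.1 j)) (by fun_prop)
  have hijt : ∀ i j t, Measurable fun z : (κ → E) × (ι → E) => h (z.2 i) (z.1 j) t :=
    fun i j t => (measurable_pi_apply t).comp (hij i j)
  have hQm : Measurable fun z : (κ → E) × (ι → E) =>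
      ⨆ t, ∑ i, ∑ j, ‖h (z.2 i) (z.1 j) t‖ₑ ^ 2 := by
    refine Measurable.iSup fun t => Finset.measurable_sum _ fun i _ =>
      Finset.measurable_sum _ fun j _ => (hijt i j t).enorm.pow_const _
  have hsm : ∀ (s : ι → ℤˣ) (s' : κ → ℤˣ), Measurable fun z : (κ → E) × (ι → E) =>
      ∑ i, ∑ j, (sgn (s i) * sgn (s' j)) • h (z.2 i) (z.1 j) := fun s s' =>
    Finset.measurable_sum _ fun i _ => Finset.measurable_sum _ fun j _ => (hij i j).fun_const_smul _
  have hsgn := lintegral_enorm_bilinear_le_sgn (ι := ι) (κ := κ) F hm hl hl0 hr hr0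
  set A := ∫⁻ y : κ → E, ∫⁻ x : ι → E, ‖∑ i, ∑ j, h (x i) (y j)‖ₑ ∂μ ∂ν
  have h1 : A / 4 ≤ ∫⁻ z, ENNReal.ofReal (signAvg κ fun s' => signAvg ι fun s =>
      ‖∑ i, ∑ j, (sgn (s i) * sgn (s' j)) • h (z.2 i) (z.1 j)‖) ∂(ν.prod μ) := by
    refine le_lintegral_prod_signAvg (fun s s' => (hsm s s').norm)
      (fun _ _ _ => norm_nonneg _) fun s s' => ?_
    simp_rw [ofReal_norm]
    rw [lintegral_prod _ (hsm s s').enorm.aemeasurable,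
      ENNReal.div_le_iff (by norm_num) (by norm_num), mul_comm _ 4]
    exact hsgn s s'
  -- For fixed data the chaos bound applies with `σ ^ 2` equal to the largest sum of squares `Q`.
  have h2 : ∀ z : (κ → E) × (ι → E), ENNReal.ofReal (signAvg κ fun s' => signAvg ι fun s =>
      ‖∑ i, ∑ j, (sgn (s i) * sgn (s' j)) • h (z.2 i) (z.1 j)‖) ≤
      ENNReal.ofReal (√2 * L) * (⨆ t, ∑ i, ∑ j, ‖h (z.2 i) (z.1 j) t‖ₑ ^ 2) ^ (1 / 2 : ℝ) := by
    intro z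
    set Q := ⨆ t, ∑ i, ∑ j, ‖h (z.2 i) (z.1 j) t‖ₑ ^ 2 with hQ
    have hQt : ∀ t, ∑ i, ∑ j, ‖h (z.2 i) (z.1 j) t‖ₑ ^ 2 =
        ENNReal.ofReal (∑ i, ∑ j, h (z.2 i) (z.1 j) t ^ 2) := by
      intro t
      rw [ENNReal.ofReal_sum_of_nonneg fun i _ => Finset.sum_nonneg fun j _ => sq_nonneg _]
      refine Finset.sum_congr rfl fun i _ => ?_
      rw [ENNReal.ofReal_sum_of_nonneg fun j _ => sq_nonneg _]
      refine Finset.sum_congr rfl fun j _ => ?_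
      rw [← ofReal_norm, ← ENNReal.ofReal_pow (norm_nonneg _), Real.norm_eq_abs, sq_abs]
    have hQfin : Q ≠ ∞ := by
      rw [hQ, ← Finset.sup_univ_eq_iSup]
      refine (Finset.sup_lt_iff (by simp)).2 (fun t _ => ?_) |>.ne
      rw [hQt]
      exact ENNReal.ofReal_lt_top
    have h3 := signAvg_chaos_norm_le (fun i j => h (z.2 i) (z.1 j)) (σ := √Q.toReal)
      (Real.sqrt_nonneg _) (by
        intro t
        rw [Real.sq_sqrt ENNReal.toReal_nonneg]
        have : ENNReal.ofReal (∑ i, ∑ j, h (z.2 i) (z.1 j) t ^ 2) ≤ Q := by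
          rw [← hQt]
          exact le_iSup (fun t => ∑ i, ∑ j, ‖h (z.2 i) (z.1 j) t‖ₑ ^ 2) t
        exact (ENNReal.ofReal_le_iff_le_toReal hQfin).1 this)
    refine (ENNReal.ofReal_le_ofReal h3).trans_eq ?_
    rw [mul_right_comm, ENNReal.ofReal_mul (by positivity)]
    congr 1
    rw [Real.sqrt_eq_rpow, ← ENNReal.ofReal_rpow_of_nonneg ENNReal.toReal_nonneg (by norm_num),
      ENNReal.ofReal_toReal hQfin]
  have h3 : A / 4 ≤ ENNReal.ofReal (√2 * L) *
      (∫⁻ y : κ → E, ∫⁻ x : ι → E, ⨆ t, ∑ i, ∑ j, ‖h (x i) (y j) t‖ₑ ^ 2 ∂μ ∂ν) ^ (1 / 2 : ℝ) := by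
    refine h1.trans ((lintegral_mono h2).trans ?_)
    rw [lintegral_const_mul' _ _ (by finiteness)]
    gcongr
    refine (lintegral_rpow_half_le _ hQm).trans_eq ?_
    rw [lintegral_prod _ hQm.aemeasurable]
  rw [ENNReal.div_le_iff (by norm_num) (by norm_num)] at h3
  exact h3.trans_eq (by ring)

end Bilinear

/-! ### Decoupling by random splits of the index set. -/

section Decoupling

/-- Flipping the sign at `i` permutes the patterns, so a function odd in that sign sums to zero. -/
theorem sum_sgn_eq_zero_of_neg {ι : Type*} [Fintype ι] [DecidableEq ι] {φ : (ι → ℤˣ) → ℝ} (i : ι)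
    (h : ∀ s, φ (s * Pi.mulSingle i (-1)) = -φ s) : ∑ s, φ s = 0 := by
  have h1 := Equiv.sum_comp (Equiv.mulRight (Pi.mulSingle i (-1 : ℤˣ))) φ
  simp only [Equiv.coe_mulRight, h, Finset.sum_neg_distrib] at h1
  linarith

/-- The number of sign patterns separating two distinct indices, weighted. -/
theorem sum_sgn_separating {ι : Type*} [Fintype ι] [DecidableEq ι] {i j : ι} (hij : i ≠ j) :
    ∑ s : ι → ℤˣ, (1 + sgn (s i)) * (1 - sgn (s j)) = 2 ^ Fintype.card ι := by
  have e1 : ∑ s : ι → ℤˣ, sgn (s i) = 0 :=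
    sum_sgn_eq_zero_of_neg i fun s => by simp [sgn]
  have e2 : ∑ s : ι → ℤˣ, sgn (s j) = 0 :=
    sum_sgn_eq_zero_of_neg j fun s => by simp [sgn]
  have e3 : ∑ s : ι → ℤˣ, sgn (s i) * sgn (s j) = 0 :=
    sum_sgn_eq_zero_of_neg i fun s => by simp [sgn, Pi.mulSingle_eq_of_ne hij.symm]
  have e4 : ∀ s : ι → ℤˣ, (1 + sgn (s i)) * (1 - sgn (s j)) =
      1 + sgn (s i) - sgn (s j) - sgn (s i) * sgn (s j) := fun s => by ring
  simp_rw [e4, Finset.sum_sub_distrib, Finset.sum_add_distrib, e1, e2, e3]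
  simp [Fintype.card_units_int]

theorem sum_sum_Ioi_eq {n : ℕ} {V : Type*} [AddCommGroup V] [Module ℝ V]
    (a : Fin n → Fin n → V) (ha : ∀ i j, a i j = a j i) :
    ∑ i, ∑ j, (if i = j then 0 else a i j) = (2 : ℝ) • ∑ i, ∑ j ∈ Finset.Ioi i, a i j := by
  have h1 : ∀ i, ∑ j, (if i = j then 0 else a i j) =
      ∑ j ∈ Finset.Ioi i, a i j + ∑ j ∈ Finset.Iio i, a i j := by
    intro i
    rw [← Finset.sum_filter_add_sum_filter_not Finset.univ (fun j => i < j)]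
    congr 1
    · refine Finset.sum_congr (by ext; simp) fun j hj => if_neg (Finset.mem_Ioi.1 hj).ne
    · rw [← Finset.sum_subset (s₁ := Finset.Iio i) (fun j hj => by
        simpa using (Finset.mem_Iio.1 hj).le) (fun j hj hj' => by
        have h3 : j = i := le_antisymm (by simpa using hj) (by simpa using hj')
        simp [h3])]
      exact Finset.sum_congr rfl fun j hj => if_neg (Finset.mem_Iio.1 hj).ne'
  simp_rw [h1, Finset.sum_add_distrib]
  rw [two_smul]
  congr 1
  rw [Finset.sum_comm' (t' := Finset.univ) (s' := fun j => Finset.Ioi j) (by simp)]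
  simp_rw [fun i j => ha j i]

/-- A sum over pairs is twice the average over random splits of the sum across the split. -/
theorem sum_split_eq {n : ℕ} {V : Type*} [AddCommGroup V] [Module ℝ V]
    (a : Fin n → Fin n → V) (ha : ∀ i j, a i j = a j i) :
    (2 : ℝ) ^ n • ∑ i, ∑ j ∈ Finset.Ioi i, a i j =
      (2 : ℝ) • ∑ s : Fin n → ℤˣ, ∑ i : {i // s i = 1}, ∑ j : {j // ¬ s j = 1}, a i j := by
  -- `(1 + s i) * (1 - s j) / 4` is the indicator of `s i = 1, s j = -1`. It averages to `1 / 4` for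
  -- `i ≠ j`, and each unordered pair is counted in two orders.
  have h1 : ∀ s : Fin n → ℤˣ, ∑ i : {i // s i = 1}, ∑ j : {j // ¬ s j = 1}, a i j =
      (1 / 4 : ℝ) • ∑ i, ∑ j, ((1 + sgn (s i)) * (1 - sgn (s j))) • a i j := by
    intro s
    rw [← Finset.sum_subtype (Finset.univ.filter fun i => s i = 1) (by simp)
      (fun i => ∑ j : {j // ¬ s j = 1}, a i j), Finset.sum_filter, Finset.smul_sum]
    refine Finset.sum_congr rfl fun i _ => ?_
    rw [← Finset.sum_subtype (Finset.univ.filter fun j => ¬ s j = 1) (by simp)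
      (fun j => a i j), Finset.sum_filter, Finset.smul_sum]
    rcases Int.units_eq_one_or (s i) with hi | hi
    · rw [if_pos hi]
      refine Finset.sum_congr rfl fun j _ => ?_
      rcases Int.units_eq_one_or (s j) with hj | hj
      · simp [hj, sgn]
      · simp only [hi, hj, sgn]
        rw [if_pos (by decide), smul_smul]
        norm_num
    · rw [if_neg (by rw [hi]; decide)]
      simp [hi, sgn]
  simp_rw [h1]
  rw [← Finset.smul_sum, Finset.sum_comm]
  have h2 : ∀ i : Fin n, ∑ s : Fin n → ℤˣ, ∑ j, ((1 + sgn (s i)) * (1 - sgn (s j))) • a i j =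
      (2 : ℝ) ^ n • ∑ j, (if i = j then 0 else a i j) := by
    intro i
    rw [Finset.sum_comm, Finset.smul_sum]
    refine Finset.sum_congr rfl fun j _ => ?_
    rw [← Finset.sum_smul]
    split_ifs with hij
    · subst hij
      have : ∀ s : Fin n → ℤˣ, (1 + sgn (s i)) * (1 - sgn (s i)) = 0 := by
        intro s
        rcases Int.units_eq_one_or (s i) with hi | hi <;> simp [hi, sgn]
      simp [this]
    · rw [sum_sgn_separating hij, Fintype.card_fin]
  simp_rw [h2]
  rw [← Finset.smul_sum, sum_sum_Ioi_eq a ha, smul_smul, smul_smul, smul_smul]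
  congr 1
  ring

theorem enorm_sum_Ioi_le {n : ℕ} {V : Type*} [NormedAddCommGroup V] [NormedSpace ℝ V]
    (a : Fin n → Fin n → V) (ha : ∀ i j, a i j = a j i) :
    2 ^ n * ‖∑ i, ∑ j ∈ Finset.Ioi i, a i j‖ₑ ≤
      2 * ∑ s : Fin n → ℤˣ, ‖∑ i : {i // s i = 1}, ∑ j : {j // ¬ s j = 1}, a i j‖ₑ := by
  have h := congrArg (fun v => ‖v‖ₑ) (sum_split_eq a ha)
  simp only [enorm_smul, enorm_pow] at h
  have h2 : ‖(2 : ℝ)‖ₑ = 2 := by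
    rw [Real.enorm_of_nonneg (by norm_num)]; simp
  rw [h2] at h
  rw [h]
  gcongr
  exact enorm_sum_le _ _

end Decoupling

/-! ### Bounds between two blocks, and their average over splits. -/

section Block

variable {T E : Type*} [Fintype T] [MeasurableSpace E]

/-- Subadditivity of the square root, separating the `D_2` part from the maximum part. -/
theorem rpow_half_add_sq_le (a b c d : ℝ) (ha : 0 ≤ a) (hc : 0 ≤ c) (A B : ℝ≥0∞)
    (hb : a ^ 2 = b) (hd : c ^ 2 = d) :
    (ENNReal.ofReal b * A ^ 2 + ENNReal.ofReal d * B ^ 2) ^ (1 / 2 : ℝ) ≤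
      ENNReal.ofReal a * A + ENNReal.ofReal c * B := by
  have key : ∀ u : ℝ≥0∞, (u ^ 2) ^ (1 / 2 : ℝ) = u := fun u => by
    rw [← ENNReal.rpow_natCast, ← ENNReal.rpow_mul]; norm_num
  refine (ENNReal.rpow_add_le_add_rpow _ _ (by norm_num) (by norm_num)).trans_eq ?_
  rw [← hb, ← hd, ENNReal.ofReal_pow ha, ENNReal.ofReal_pow hc, ← mul_pow, ← mul_pow, key, key]

/-- The bound for a decoupled canonical sum between two complementary blocks of indices. -/
theorem lintegral_enorm_block_le [Nonempty T] (F : Measure E) [IsProbabilityMeasure F]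
    {h : E → E → T → ℝ} (hm : Measurable fun z : E × E => h z.1 z.2)
    (hl : ∀ x, Integrable (fun y => h x y) F) (hl0 : ∀ x, ∫ y, h x y ∂F = 0)
    (hr : ∀ y, Integrable (fun x => h x y) F) (hr0 : ∀ y, ∫ x, h x y ∂F = 0)
    {n : ℕ} (q : Fin n → Prop) [DecidablePred q] {D W : ℝ≥0∞}
    (hD : ⨆ t, ∫⁻ y, ∫⁻ x, ‖h x y t‖ₑ ^ 2 ∂F ∂F ≤ D ^ 2)
    (hW : ∫⁻ x : Fin n → E, ‖fun (i : {i // q i}) (j : {j // ¬ q j}) => h (x i) (x j)‖ₑ ^ 2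
      ∂(Measure.pi fun _ => F) ≤ W ^ 2) :
    ∫⁻ x : Fin n → E, ‖∑ i : {i // q i}, ∑ j : {j // ¬ q j}, h (x i) (x j)‖ₑ
        ∂(Measure.pi fun _ => F) ≤
      4 * ENNReal.ofReal (√2 * Real.log (4 * Fintype.card T)) *
        (ENNReal.ofReal (6 * n) * D +
          ENNReal.ofReal √(48 * n * Real.log (2 * Fintype.card T)) * W) := by
  have hL0 := log_two_mul_card_nonneg (T := T)
  have hmp := measurePreserving_piEquivPiSubtypeProd (fun _ : Fin n => F) q
  have hij : ∀ (i : {i // q i}) (j : {j // ¬ q j}),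
      Measurable fun z : ({i // q i} → E) × ({j // ¬ q j} → E) => h (z.1 i) (z.2 j) := fun i j =>
    hm.comp (f := fun z : ({i // q i} → E) × ({j // ¬ q j} → E) => (z.1 i, z.2 j)) (by fun_prop)
  have m1 : Measurable fun z : ({i // q i} → E) × ({j // ¬ q j} → E) =>
      ‖∑ i, ∑ j, h (z.1 i) (z.2 j)‖ₑ :=
    (Finset.measurable_sum _ fun i _ => Finset.measurable_sum _ fun j _ => hij i j).enorm
  have m2 : Measurable fun z : ({i // q i} → E) × ({j // ¬ q j} → E) =>
      ‖fun i j => h (z.1 i) (z.2 j)‖ₑ ^ 2 :=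
    (measurable_pi_iff.2 fun i => measurable_pi_iff.2 fun j => hij i j).enorm.pow_const _
  have e1 := hmp.lintegral_comp m1
  have e2 := hmp.lintegral_comp m2
  rw [lintegral_prod_symm _ m1.aemeasurable] at e1
  rw [lintegral_prod_symm _ m2.aemeasurable] at e2
  have e2' := e2.symm.trans_le hW
  refine e1.trans_le ((lintegral_enorm_bilinear_le F hm hl hl0 hr hr0).trans ?_)
  gcongr
  refine le_trans ?_ (rpow_half_add_sq_le (6 * n) ((6 * n) ^ 2) _
    (48 * n * Real.log (2 * Fintype.card T)) (by positivity) (Real.sqrt_nonneg _) D W rfl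
    (Real.sq_sqrt (by positivity)))
  refine ENNReal.rpow_le_rpow ?_ (by norm_num)
  refine (lintegral_iSup_sum_sq_le F hm).trans ?_
  have c1 : Fintype.card {i // q i} ≤ n := (Fintype.card_subtype_le q).trans_eq (by simp)
  have c2 : Fintype.card {i // ¬ q i} ≤ n :=
    (Fintype.card_subtype_le fun i => ¬ q i).trans_eq (by simp)
  -- The block sizes add up to `n`, hence `48 |I| + 8 |J| ≤ 48 n`.
  have c3 : Fintype.card {i // q i} + Fintype.card {i // ¬ q i} = n := by
    rw [Fintype.card_subtype_compl, Fintype.card_fin]; omega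
  refine add_le_add ?_ ?_
  · refine mul_le_mul' ?_ hD
    rw [show ((6 * n : ℝ)) ^ 2 = ((36 * n * n : ℕ) : ℝ) by push_cast; ring, ENNReal.ofReal_natCast]
    exact_mod_cast Nat.mul_le_mul (Nat.mul_le_mul le_rfl c1) c2
  · refine mul_le_mul' ?_ e2'
    rw [ENNReal.ofReal_mul (by positivity)]
    gcongr
    rw [show (48 * n : ℝ) = ((48 * n : ℕ) : ℝ) by push_cast; ring, ENNReal.ofReal_natCast]
    have : 48 * Fintype.card {i // q i} + 8 * Fintype.card {i // ¬ q i} ≤ 48 * n := by omega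
    exact_mod_cast this

/-- The bound for a canonical sum over pairs, after averaging over all splits. -/
theorem lintegral_enorm_sum_Ioi_le [Nonempty T] (F : Measure E) [IsProbabilityMeasure F]
    {h : E → E → T → ℝ} (hm : Measurable fun z : E × E => h z.1 z.2)
    (hsymm : ∀ x y, h x y = h y x)
    (hl : ∀ x, Integrable (fun y => h x y) F) (hl0 : ∀ x, ∫ y, h x y ∂F = 0)
    (hr : ∀ y, Integrable (fun x => h x y) F) (hr0 : ∀ y, ∫ x, h x y ∂F = 0)
    {n : ℕ} {D W : ℝ≥0∞}
    (hD : ⨆ t, ∫⁻ y, ∫⁻ x, ‖h x y t‖ₑ ^ 2 ∂F ∂F ≤ D ^ 2)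
    (hW : ∀ s : Fin n → ℤˣ, ∫⁻ x : Fin n → E,
      ‖fun (i : {i // s i = 1}) (j : {j // ¬ s j = 1}) => h (x i) (x j)‖ₑ ^ 2
      ∂(Measure.pi fun _ => F) ≤ W ^ 2) :
    ∫⁻ x : Fin n → E, ‖∑ i, ∑ j ∈ Finset.Ioi i, h (x i) (x j)‖ₑ ∂(Measure.pi fun _ => F) ≤
      8 * ENNReal.ofReal (√2 * Real.log (4 * Fintype.card T)) *
        (ENNReal.ofReal (6 * n) * D +
          ENNReal.ofReal √(48 * n * Real.log (2 * Fintype.card T)) * W) := by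
  set R := 4 * ENNReal.ofReal (√2 * Real.log (4 * Fintype.card T)) *
        (ENNReal.ofReal (6 * n) * D +
          ENNReal.ofReal √(48 * n * Real.log (2 * Fintype.card T)) * W) with hR
  have hB : ∀ s : Fin n → ℤˣ, ∫⁻ x : Fin n → E,
      ‖∑ i : {i // s i = 1}, ∑ j : {j // ¬ s j = 1}, h (x i) (x j)‖ₑ
        ∂(Measure.pi fun _ => F) ≤ R := fun s =>
    lintegral_enorm_block_le F hm hl hl0 hr hr0 (fun i => s i = 1) hD (hW s)
  have hij : ∀ i j : Fin n, Measurable fun x : Fin n → E => h (x i) (x j) := fun i j =>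
    hm.comp (f := fun x : Fin n → E => (x i, x j)) (by fun_prop)
  have hc0 : (2 : ℝ≥0∞) ^ n ≠ 0 := pow_ne_zero _ two_ne_zero
  have hct : (2 : ℝ≥0∞) ^ n ≠ ∞ := ENNReal.pow_ne_top ENNReal.ofNat_ne_top
  set B : (Fin n → ℤˣ) → (Fin n → E) → ℝ≥0∞ := fun s x =>
    ‖∑ i : {i // s i = 1}, ∑ j : {j // ¬ s j = 1}, h (x i) (x j)‖ₑ with hBdef
  have hBm : ∀ s, Measurable (B s) := fun s =>
    (Finset.measurable_sum _ fun (i : {i // s i = 1}) _ =>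
      Finset.measurable_sum _ fun (j : {j // ¬ s j = 1}) _ => hij i j).enorm
  have hpt : ∀ x : Fin n → E, (2 : ℝ≥0∞) ^ n * ‖∑ i, ∑ j ∈ Finset.Ioi i, h (x i) (x j)‖ₑ ≤
      2 * ∑ s, B s x := by
    intro x
    have := enorm_sum_Ioi_le (fun i j => h (x i) (x j)) fun i j => hsymm _ _
    simpa only [hBdef] using this
  have hsum : ∑ s, ∫⁻ x, B s x ∂(Measure.pi fun _ => F) ≤ (2 : ℝ≥0∞) ^ n * R := by
    refine (Finset.sum_le_sum fun s _ => hB s).trans_eq ?_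
    rw [Finset.sum_const, Finset.card_univ, card_signs, nsmul_eq_mul, Fintype.card_fin]
    push_cast
    rfl
  clear_value B R
  have h1 : (2 : ℝ≥0∞) ^ n * ∫⁻ x : Fin n → E, ‖∑ i, ∑ j ∈ Finset.Ioi i, h (x i) (x j)‖ₑ
      ∂(Measure.pi fun _ => F) ≤ (2 : ℝ≥0∞) ^ n * (2 * R) := by
    generalize (2 : ℝ≥0∞) ^ n = c at *
    rw [← lintegral_const_mul' _ _ hct]
    refine (lintegral_mono hpt).trans ?_
    rw [lintegral_const_mul' _ _ ENNReal.ofNat_ne_top, lintegral_finsetSum _ fun s _ => hBm s,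
      mul_left_comm]
    gcongr
  generalize (2 : ℝ≥0∞) ^ n = c at h1 hc0 hct
  have h2 := (ENNReal.mul_le_mul_iff_right hc0 hct).1 h1
  refine h2.trans_eq ?_
  rw [hR]; ring

end Block

/-! ### Translation between matrix kernels and vector-valued kernels. -/

section Kernels

variable {p n : ℕ}

/-- A matrix kernel viewed as a kernel with values in the vectors of its entries. -/
def MatrixKernel.entries (f : MatrixKernel p) (x y : Fin p → ℝ) : Fin p × Fin p → ℝ :=
  fun t => f x y t.1 t.2

theorem maxNorm_le_norm [Nonempty (Fin p)] (A : Matrix (Fin p) (Fin p) ℝ) :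
    maxNorm A ≤ ‖fun t : Fin p × Fin p => A t.1 t.2‖ :=
  ciSup_le fun m => ciSup_le fun k =>
    norm_le_pi_norm (fun t : Fin p × Fin p => A t.1 t.2) (m, k)

theorem norm_le_maxNorm [Nonempty (Fin p)] (A : Matrix (Fin p) (Fin p) ℝ) :
    ‖fun t : Fin p × Fin p => A t.1 t.2‖ ≤ maxNorm A := by
  refine (pi_norm_le_iff_of_nonempty _).2 fun t => ?_
  exact (le_ciSup (f := fun k => |A t.1 k|) (Set.finite_range _).bddAbove t.2).trans
    (le_ciSup (f := fun m => ⨆ k, |A m k|) (Set.finite_range _).bddAbove t.1)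

/-- `maxKernel` only sees pairs `i < j`, while a split may pair a larger index with a smaller one.
Symmetry of the kernel covers that case. -/
theorem MatrixKernel.norm_entries_le_maxKernel [Nonempty (Fin p)] {f : MatrixKernel p}
    (hs : f.IsSymmetric) (x x' : Fin n → Fin p → ℝ) {i j : Fin n} (hij : i ≠ j) :
    ‖f.entries (x i) (x j)‖ ≤ f.maxKernel x x' := by
  have key : ∀ {i j : Fin n}, i < j → ‖f.entries (x i) (x j)‖ ≤ f.maxKernel x x' := by
    intro i j hij
    refine (norm_le_maxNorm (f (x i) (x j))).trans ((le_max_left _ _).trans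
      (le_ciSup (f := fun ij : {ij : Fin n × Fin n // ij.1 < ij.2} =>
        max (maxNorm (f (x ij.1.1) (x ij.1.2))) (maxNorm (f (x ij.1.1) (x' ij.1.2))))
        (Set.finite_range _).bddAbove ⟨(i, j), hij⟩))
  rcases hij.lt_or_gt with h | h
  · exact key h
  · have := key h
    unfold MatrixKernel.entries at this ⊢
    rwa [hs (x i) (x j)]

theorem MatrixKernel.ofReal_maxNorm_uStat_le [Nonempty (Fin p)] (f : MatrixKernel p)
    (x : Fin n → Fin p → ℝ) :
    ENNReal.ofReal (maxNorm (f.uStat x)) ≤ ENNReal.ofReal ((n.choose 2 : ℕ) : ℝ)⁻¹ *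
      ‖∑ i, ∑ j ∈ Finset.Ioi i, f.entries (x i) (x j)‖ₑ := by
  rw [← ofReal_norm (∑ i, ∑ j ∈ Finset.Ioi i, f.entries (x i) (x j)),
    ← ENNReal.ofReal_mul (by positivity)]
  refine ENNReal.ofReal_le_ofReal ((maxNorm_le_norm _).trans_eq ?_)
  rw [← Real.norm_of_nonneg (inv_nonneg.2 (Nat.cast_nonneg (α := ℝ) (n.choose 2))), ← norm_smul]
  congr 1
  ext t
  simp [MatrixKernel.uStat, MatrixKernel.entries, Matrix.sum_apply, Finset.sum_apply]

theorem MatrixKernel.iSup_lintegral_sq_le_entryNorm_sq (f : MatrixKernel p) (hf : f.IsMeasurable)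
    (F : Measure (Fin p → ℝ)) [IsProbabilityMeasure F] :
    ⨆ t, ∫⁻ y, ∫⁻ x, ‖f.entries x y t‖ₑ ^ 2 ∂F ∂F ≤ f.entryNorm F 2 ^ 2 := by
  refine iSup_le fun t => ?_
  have h1 : eLpNorm (fun z : (Fin p → ℝ) × (Fin p → ℝ) => f z.1 z.2 t.1 t.2) 2 (F.prod F) ≤
      f.entryNorm F 2 :=
    le_iSup₂ (f := fun m k => eLpNorm (fun z : (Fin p → ℝ) × (Fin p → ℝ) => f z.1 z.2 m k) 2
      (F.prod F)) t.1 t.2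
  refine le_trans (le_of_eq ?_) (pow_le_pow_left' h1 2)
  have h2 := eLpNorm_nnreal_pow_eq_lintegral (p := 2)
    (f := fun z : (Fin p → ℝ) × (Fin p → ℝ) => f z.1 z.2 t.1 t.2) (μ := F.prod F) (by norm_num)
  have h3 : (((2 : NNReal) : ℝ)) = ((2 : ℕ) : ℝ) := by norm_num
  rw [h3] at h2
  simp only [ENNReal.rpow_natCast] at h2
  rw [ENNReal.coe_ofNat] at h2
  rw [h2, lintegral_prod_symm _ ((hf t.1 t.2).enorm.pow_const _).aemeasurable]
  rfl

theorem HasLaw.pi_of_iIndepFun {ι E Ω : Type*} [Fintype ι] [MeasurableSpace E]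
    [MeasurableSpace Ω] {P : Measure Ω} [IsProbabilityMeasure P] {F : Measure E}
    {X : ι → Ω → E} (hX : ∀ i, HasLaw (X i) F P) (h : iIndepFun X P) :
    HasLaw (fun ω i => X i ω) (Measure.pi fun _ => F) P where
  aemeasurable := aemeasurable_pi_iff.2 fun i => (hX i).aemeasurable
  map_eq := by
    rw [h.map_fun_eq_pi_map fun i => (hX i).aemeasurable]
    simp_rw [(hX _).map_eq]

/-- Complementary blocks never pair an index with itself, so the array is dominated by `M`. Second
moments are then bounded by fourth moments through Cauchy–Schwarz. -/
theorem MatrixKernel.lintegral_block_sq_le [Nonempty (Fin p)] {f : MatrixKernel p}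
    (hf : f.IsMeasurable) (hs : f.IsSymmetric) {F : Measure (Fin p → ℝ)} [IsProbabilityMeasure F]
    {Ω : Type*} [MeasurableSpace Ω] {P : Measure Ω} [IsProbabilityMeasure P]
    {X X' : Fin n → Ω → Fin p → ℝ}
    (hX : HasLaw (fun ω i => X i ω) (Measure.pi fun _ => F) P)
    (q : Fin n → Prop) [DecidablePred q] :
    ∫⁻ x : Fin n → Fin p → ℝ,
      ‖fun (i : {i // q i}) (j : {j // ¬ q j}) => f.entries (x i) (x j)‖ₑ ^ 2
      ∂(Measure.pi fun _ => F) ≤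
      eLpNorm (fun ω => f.maxKernel (fun i => X i ω) (fun i => X' i ω)) 4 P ^ 2 := by
  set φ : (Fin n → Fin p → ℝ) → ℝ≥0∞ := fun x =>
    ‖fun (i : {i // q i}) (j : {j // ¬ q j}) => f.entries (x i) (x j)‖ₑ with hφ
  have hent : Measurable fun z : (Fin p → ℝ) × (Fin p → ℝ) => f.entries z.1 z.2 :=
    measurable_pi_iff.2 fun t => hf t.1 t.2
  have hφm : Measurable φ := by
    refine (measurable_pi_iff.2 fun i => measurable_pi_iff.2 fun j => ?_ : Measurable _).enorm
    exact hent.comp (f := fun x : Fin n → Fin p → ℝ => (x i, x j)) (by fun_prop)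
  have h4 := eLpNorm_nnreal_pow_eq_lintegral (p := 4)
    (f := fun ω => f.maxKernel (fun i => X i ω) (fun i => X' i ω)) (μ := P) (by norm_num)
  rw [show (((4 : NNReal) : ℝ)) = ((4 : ℕ) : ℝ) by norm_num] at h4
  simp only [ENNReal.rpow_natCast] at h4
  rw [ENNReal.coe_ofNat] at h4
  set M := eLpNorm (fun ω => f.maxKernel (fun i => X i ω) (fun i => X' i ω)) 4 P
  have h1 : ∫⁻ x, φ x ^ 4 ∂(Measure.pi fun _ => F) ≤ M ^ 4 := by
    rw [h4, ← hX.map_eq, lintegral_map' (by fun_prop) hX.aemeasurable]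
    refine lintegral_mono fun ω => ?_
    refine pow_le_pow_left' ?_ 4
    rw [hφ]
    simp only
    rw [enorm_pi_eq_iSup]
    refine iSup_le fun i => ?_
    rw [enorm_pi_eq_iSup]
    refine iSup_le fun j => ?_
    have hij : (i : Fin n) ≠ j := fun h => j.2 (h ▸ i.2)
    have := MatrixKernel.norm_entries_le_maxKernel hs (fun i => X i ω) (fun i => X' i ω) hij
    rw [enorm_le_iff_norm_le]
    exact this.trans (le_abs_self _)
  have h2 := lintegral_rpow_half_le (Measure.pi fun _ : Fin n => F) (hφm.pow_const 4)
  have key : ∀ u : ℝ≥0∞, (u ^ 4) ^ (1 / 2 : ℝ) = u ^ 2 := fun u => by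
    rw [← ENNReal.rpow_natCast, ← ENNReal.rpow_natCast, ← ENNReal.rpow_mul]; norm_num
  simp only [key] at h2
  refine h2.trans ?_
  rw [← key M]
  exact ENNReal.rpow_le_rpow h1 (by norm_num)

end Kernels

/-! ### Numerical bounds and the final assembly. -/

theorem log_mul_sq_le {p : ℕ} (hp : 2 ≤ p) {c : ℝ} (hc0 : 0 < c) (hc : c ≤ 4) :
    Real.log (c * ((p * p : ℕ) : ℝ)) ≤ 4 * Real.log p := by
  have hp' : (2 : ℝ) ≤ p := by exact_mod_cast hp
  rw [show 4 * Real.log p = Real.log ((p : ℝ) ^ 4) by rw [Real.log_pow]; norm_num]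
  refine Real.log_le_log (by push_cast; positivity) ?_
  push_cast
  have : (4 : ℝ) ≤ p * p := by nlinarith
  nlinarith [mul_le_mul this (le_refl ((p : ℝ) * p)) (by positivity) (by positivity)]

theorem inv_choose_two_le {n : ℕ} (hn : 2 ≤ n) : ((n.choose 2 : ℕ) : ℝ)⁻¹ ≤ 4 / (n : ℝ) ^ 2 := by
  have hn' : (2 : ℝ) ≤ n := by exact_mod_cast hn
  rw [Nat.cast_choose_two, inv_div, div_le_div_iff₀ (by nlinarith) (by positivity)]
  nlinarith

/-- Expectation bound for canonical U-statistics. All moments are taken in `[0, ∞]`, so nothing is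
claimed through a junk value when a moment on the right-hand side is infinite. -/
theorem mainTheorem5 :
    ∃ K : ℝ, 0 < K ∧
      ∀ (b : ℝ), 0 < b →
      ∀ (n p : ℕ), 2 ≤ n → 2 ≤ p → (p : ℝ) ≤ Real.exp (b * n) →
      ∀ (F : Measure (Fin p → ℝ)) [IsProbabilityMeasure F] (f : MatrixKernel p),
        f.IsMeasurable → f.IsSymmetric → f.IsCanonical F →
        Integrable (fun z : (Fin p → ℝ) × (Fin p → ℝ) => maxNorm (f z.1 z.2)) (F.prod F) →
      ∀ {Ω : Type*} [MeasurableSpace Ω] (P : Measure Ω) [IsProbabilityMeasure P]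
        (X X' : Fin n → Ω → Fin p → ℝ),
        (∀ i, HasLaw (X i) F P) → (∀ i, HasLaw (X' i) F P) →
        iIndepFun (Sum.elim X X') P →
        ∫⁻ ω, ENNReal.ofReal (maxNorm (f.uStat fun i => X i ω)) ∂P ≤
          ENNReal.ofReal (K * max 1 (b ^ (1 / 2 : ℝ))) *
            (ENNReal.ofReal ((Real.log p / n) ^ (3 / 2 : ℝ)) *
                eLpNorm (fun ω => f.maxKernel (fun i => X i ω) (fun i => X' i ω)) 4 P +
              ENNReal.ofReal (Real.log p / n) * f.entryNorm F 2 +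
              ENNReal.ofReal ((Real.log p / n) ^ (5 / 4 : ℝ)) * f.entryNorm F 4) := by
  -- `3584 = 4 * 8 * 8 * 14`: 4 from the binomial coefficient, 8 from decoupling and symmetrization,
  -- 8 from `√2 * log (4 p ^ 2) ≤ 2 * (4 log p)`, and `14 ≥ √(48 * 4)`. With 6 in place of 14, the
  -- `D_2` term gets 1536.
  refine ⟨3584, by norm_num, ?_⟩
  intro b _ n p hn hp _ F _ f hfm hfs hfc _ Ω _ P _ X X' hX _ hind
  have : Nonempty (Fin p) := ⟨⟨0, by omega⟩⟩
  have hent : Measurable fun z : (Fin p → ℝ) × (Fin p → ℝ) => f.entries z.1 z.2 :=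
    measurable_pi_iff.2 fun t => hfm t.1 t.2
  have hl : ∀ x, Integrable (fun y => f.entries x y) F := fun x =>
    Integrable.of_eval fun t => hfc.integrable_left t.1 t.2 x
  have hr : ∀ y, Integrable (fun x => f.entries x y) F := fun y =>
    Integrable.of_eval fun t => hfc.integrable_right t.1 t.2 y
  have hl0 : ∀ x, ∫ y, f.entries x y ∂F = 0 := fun x => funext fun t => by
    rw [eval_integral fun t => (hl x).eval t]
    exact hfc.integral_left t.1 t.2 x
  have hr0 : ∀ y, ∫ x, f.entries x y ∂F = 0 := fun y => funext fun t => by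
    rw [eval_integral fun t => (hr y).eval t]
    exact hfc.integral_right t.1 t.2 y
  have hsymm : ∀ x y, f.entries x y = f.entries y x := fun x y => by
    unfold MatrixKernel.entries
    rw [hfs x y]
  have hlaw : HasLaw (fun ω i => X i ω) (Measure.pi fun _ => F) P :=
    HasLaw.pi_of_iIndepFun hX (iIndepFun.precomp (g := Sum.inl) Sum.inl_injective hind)
  set D := f.entryNorm F 2
  set W := eLpNorm (fun ω => f.maxKernel (fun i => X i ω) (fun i => X' i ω)) 4 P
  have hmain := lintegral_enorm_sum_Ioi_le (n := n) F hent hsymm hl hl0 hr hr0 (D := D) (W := W)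
    (f.iSup_lintegral_sq_le_entryNorm_sq hfm F)
    fun s => MatrixKernel.lintegral_block_sq_le hfm hfs hlaw (fun i => s i = 1)
  have hij : ∀ i j : Fin n, Measurable fun x : Fin n → Fin p → ℝ => f.entries (x i) (x j) :=
    fun i j => hent.comp (f := fun x : Fin n → Fin p → ℝ => (x i, x j)) (by fun_prop)
  have hV : ∫⁻ ω, ENNReal.ofReal (maxNorm (f.uStat fun i => X i ω)) ∂P ≤
      ENNReal.ofReal ((n.choose 2 : ℕ) : ℝ)⁻¹ *
        ∫⁻ x : Fin n → Fin p → ℝ, ‖∑ i, ∑ j ∈ Finset.Ioi i, f.entries (x i) (x j)‖ₑ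
          ∂(Measure.pi fun _ => F) := by
    rw [← hlaw.map_eq, lintegral_map' (Measurable.aemeasurable (Measurable.enorm
      (Finset.measurable_sum _ fun i _ => Finset.measurable_sum _ fun j _ => hij i j)))
      hlaw.aemeasurable, ← lintegral_const_mul' _ _ ENNReal.ofReal_ne_top]
    exact lintegral_mono fun ω => f.ofReal_maxNorm_uStat_le fun i => X i ω
  rw [Fintype.card_prod, Fintype.card_fin] at hmain
  set l := Real.log p with hldef
  have hl0' : 0 ≤ l := Real.log_natCast_nonneg p
  have hn' : (2 : ℝ) ≤ n := by exact_mod_cast hn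
  have hn0 : (0 : ℝ) < n := by linarith
  have hL4 : Real.log (4 * ((p * p : ℕ) : ℝ)) ≤ 4 * l := log_mul_sq_le hp (by norm_num) le_rfl
  have hL4' : 0 ≤ Real.log (4 * ((p * p : ℕ) : ℝ)) := by
    rw [← Nat.cast_ofNat, ← Nat.cast_mul]
    exact Real.log_natCast_nonneg _
  have hL2 : Real.log (2 * ((p * p : ℕ) : ℝ)) ≤ 4 * l :=
    log_mul_sq_le hp (by norm_num) (by norm_num)
  have hsq2 : √2 ≤ (2 : ℝ) := by rw [Real.sqrt_le_left (by norm_num)]; norm_num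
  have hsqrt : √(48 * n * Real.log (2 * ((p * p : ℕ) : ℝ))) ≤ 14 * √(n * l) := by
    rw [show 14 * √(n * l) = √(14 ^ 2 * (n * l)) by
      rw [Real.sqrt_mul (by norm_num) (n * l), Real.sqrt_sq (by norm_num)]]
    refine Real.sqrt_le_sqrt ?_
    have h1 : 0 ≤ n * l := by positivity
    nlinarith [mul_le_mul_of_nonneg_left hL2 hn0.le]
  have hpow : (l / n) ^ (3 / 2 : ℝ) = l / n ^ 2 * √(n * l) := by
    have hx : 0 ≤ l / n := by positivity
    have h1 : √(n * l) = n * √(l / n) := by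
      rw [show n * l = n ^ 2 * (l / n) by field_simp, Real.sqrt_mul (by positivity),
        Real.sqrt_sq hn0.le]
    rw [show (3 / 2 : ℝ) = 1 + 1 / 2 by norm_num, Real.rpow_add' hx (by norm_num),
      Real.rpow_one, ← Real.sqrt_eq_rpow, h1]
    field_simp
  have hC : ENNReal.ofReal 3584 ≤ ENNReal.ofReal (3584 * max 1 (b ^ (1 / 2 : ℝ))) :=
    ENNReal.ofReal_le_ofReal (le_mul_of_one_le_right (by norm_num) (le_max_left _ _))
  calc _ ≤ ENNReal.ofReal (4 / (n : ℝ) ^ 2) * (ENNReal.ofReal 8 * ENNReal.ofReal (2 * (4 * l)) *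
        (ENNReal.ofReal (6 * n) * D + ENNReal.ofReal (14 * √(n * l)) * W)) := by
        refine hV.trans (mul_le_mul' (ENNReal.ofReal_le_ofReal (inv_choose_two_le hn))
          (hmain.trans ?_))
        rw [ENNReal.ofReal_ofNat]
        gcongr
    _ = ENNReal.ofReal (1536 * (l / n)) * D + ENNReal.ofReal (3584 * (l / n) ^ (3 / 2 : ℝ)) * W := by
        rw [mul_add, mul_add]
        simp only [← mul_assoc]
        rw [← ENNReal.ofReal_mul (by positivity), ← ENNReal.ofReal_mul (by positivity),
          ← ENNReal.ofReal_mul (by positivity), ← ENNReal.ofReal_mul (by positivity), hpow]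
        congr 3
        · field_simp
          ring
        · ring
    _ ≤ ENNReal.ofReal 3584 * (ENNReal.ofReal (l / n)) * D +
        ENNReal.ofReal 3584 * ENNReal.ofReal ((l / n) ^ (3 / 2 : ℝ)) * W := by
        rw [← ENNReal.ofReal_mul (by norm_num), ← ENNReal.ofReal_mul (by norm_num)]
        gcongr
        norm_num
    _ = ENNReal.ofReal 3584 * (ENNReal.ofReal ((l / n) ^ (3 / 2 : ℝ)) * W +
        ENNReal.ofReal (l / n) * D) := by ring
    -- The nonnegative `D_4` term is added here.
    _ ≤ _ := mul_le_mul' hC le_self_add
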